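/- Conventions. $\mathbb N^*=\{1,2,\dots\}$, $\log$ is the logarithm to base $2$, $\ln$ the natural logarithm, $\log^{(2)}=\log\circ\log$, $\log^{a}(x)=(\log x)^a$, and $1/\infty=0$. Let $p,q\in[1,\infty]$. The ratio $p/(pb+1)$ is understood as $1/b$ for $p=\infty$, and $p^{1/p}$ as $1$ for $p=\infty$. For a sequence $\{\mu_n\}_{n\in\mathbb N^*}$ of positive real numbers, the $p$-ellipsoid with semi-axes $\{\mu_n\}$ is $$\mathcal E_p=\Big\{x\in\ell^p(\mathbb N^*;\mathbb R)\ :\ \Big(\sum_{n\ge 1}|x_n/\mu_n|^p\Big)^{1/p}\le 1\Big\},$$ with $\sup_n|x_n/\mu_n|\le 1$ in place of the sum condition if $p=\infty$. For $\varepsilon>0$, $N(\varepsilon;\mathcal E_p,\|\cdot\|_q)\in\mathbb N^*\cup\{\infty\}$ is the smallest number of closed $\|\cdot\|_q$-balls of radius $\varepsilon$ with centers in $\ell^q(\mathbb N^*;\mathbb R)$ that cover $\mathcal E_p$ (in (i), where $\mathcal E_p$ need not be contained in $\ell^q$, the set $\mathcal E_p$ is replaced by $\mathcal E_p\cap\ell^q$),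 and $H(\varepsilon;\mathcal E_p,\|\cdot\|_q)=\log N(\varepsilon;\mathcal E_p,\|\cdot\|_q)$ is the metric entropy. With $\Gamma(\cdot)$ the Euler function, put $$\Gamma_{p,q}=\frac{\Gamma(1/p+1)\,p^{1/p}}{\Gamma(1/q+1)\,q^{1/q}\,e^{1/q-1/p}},\qquad b^*=b+\frac1p-\frac1q,\qquad \gamma_{p,q,b}=\Big(\frac{b}{b+\frac1p-\frac1q}\Big)^{\frac1q-\frac1p}.$$ **Statement.** Let $p,q\in[1,\infty]$, $b>0$, $c>0$, and let $\{\mu_n\}_{n\in\mathbb N^*}$ be a non-increasing sequence of positive real numbers with $\mu_n=\frac{c}{n^b}+o_{n\to\infty}\big(\frac1{n^b}\big)$. Let $\mathcal E_p$ be the $p$-ellipsoid with semi-axes $\{\mu_n\}_{n\in\mathbb N^*}$. (i) If $q\le p/(pb+1)$, then $\mathcal E_p$ (more precisely $\mathcal E_p\cap\ell^q$) is not compact in $\ell^q$, and there exists $\varepsilon^*>0$ such that $H(\varepsilon;\mathcal E_p,\|\cdot\|_q)=\infty$ for all $\varepsilon\in(0,\varepsilon^*)$. (ii) If $p/(pb+1)<q\le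 p$, then $\mathcal E_p\subset\ell^q$ and $$\frac{b}{\ln 2}\Big(\frac{\Gamma_{p,q}\,c}{\varepsilon}\Big)^{1/b^*}+o_{\varepsilon\to0}\big(\varepsilon^{-1/b^*}\big)\ \le\ H(\varepsilon;\mathcal E_p,\|\cdot\|_q)\ \le\ \Big(\frac{b}{\ln 2}+1\Big)\Big(\frac{\gamma_{p,q,b}\,c}{\varepsilon}\Big)^{1/b^*}+o_{\varepsilon\to0}\big(\varepsilon^{-1/b^*}\big).$$ (iii) If $p<q$, then $\mathcal E_p\subset\ell^q$, $$\frac{b}{\ln 2}\Big(\frac{\Gamma_{p,q}\,c}{\varepsilon}\Big)^{1/b^*}+o_{\varepsilon\to0}\big(\varepsilon^{-1/b^*}\big)\ \le\ H(\varepsilon;\mathcal E_p,\|\cdot\|_q),$$ and $$H(\varepsilon;\mathcal E_p,\|\cdot\|_q)=\begin{cases}O_{\varepsilon\to0}\big(\varepsilon^{-1/b^*}\,\log^{(2)}(\varepsilon^{-1})\big),&\text{if } b\ge1,\\ O_{\varepsilon\to0}\big(\varepsilon^{-1/b^*}\,\log^{1-b}(\varepsilon^{-1})\big),&\text{if } b<1.\end{cases}$$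 -/

import Mathlib

open Filter Topology Asymptotics
open scoped ENNReal NNReal

noncomputable section

namespace EllipsoidEntropy

/-- The ellipsoid norm of a real sequence `x` with semi-axes `μ`, with values in `[0, ∞]`:
`(∑ |x n / μ n| ^ p) ^ (1 / p)` for finite `p`, and `sup |x n / μ n|` for `p = ∞`. -/
def ellipsoidNorm (p : ℝ≥0∞) (μ x : ℕ+ → ℝ) : ℝ≥0∞ :=
  if p = ∞ then ⨆ n, ENNReal.ofReal |x n / μ n|
  else (∑' n, ENNReal.ofReal |x n / μ n| ^ p.toReal) ^ (1 / p.toReal)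

/-- The `p`-ellipsoid with semi-axes `μ`: all `x ∈ ℓ^p` of ellipsoid norm at most `1`. -/
def ellipsoid (p : ℝ≥0∞) (μ : ℕ+ → ℝ) : Set (ℕ+ → ℝ) :=
  {x | Memℓp x p ∧ ellipsoidNorm p μ x ≤ 1}

/-- The elements of the `p`-ellipsoid that lie in `ℓ^q`, as a subset of the normed space `ℓ^q`. -/
def ellipsoidIn (p q : ℝ≥0∞) (μ : ℕ+ → ℝ) : Set (lp (fun _ : ℕ+ => ℝ) q) :=
  {x | (x : ℕ+ → ℝ) ∈ ellipsoid p μ}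

/-- The metric entropy of a subset `A` of a metric space `X`: the base-2 logarithm of the smallest
number of closed balls of radius `ε` with centers in `X` that cover `A`; it is `⊤` if no finite
number of balls suffices. -/
def metricEntropy {X : Type*} [PseudoEMetricSpace X] (ε : ℝ) (A : Set X) : EReal :=
  ENNReal.log ((Metric.externalCoveringNumber ε.toNNReal A : ℕ∞) : ℝ≥0∞) / (Real.log 2 : EReal)

/-- The real number `1 / p`, equal to `0` for `p = ∞`. -/
def recip (p : ℝ≥0∞) : ℝ := (p⁻¹).toReal

/-- The threshold `p / (p b + 1)`, read as `1 / b` for `p = ∞`. -/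
def threshold (p : ℝ≥0∞) (b : ℝ) : ℝ≥0∞ :=
  if p = ∞ then ENNReal.ofReal (1 / b) else ENNReal.ofReal (p.toReal / (p.toReal * b + 1))

/-- The number `p ^ (1 / p)`, read as its limit `1` for `p = ∞`. -/
def selfRoot (p : ℝ≥0∞) : ℝ :=
  if p = ∞ then 1 else p.toReal ^ (1 / p.toReal)

/-- The constant
`Γ_{p,q} = Γ(1/p + 1) p ^ (1/p) / (Γ(1/q + 1) q ^ (1/q) e ^ (1/q - 1/p))`. -/
def GammaConst (p q : ℝ≥0∞) : ℝ :=
  Real.Gamma (recip p + 1) * selfRoot p /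
    (Real.Gamma (recip q + 1) * selfRoot q * Real.exp (recip q - recip p))

/-- The exponent `b* = b + 1/p - 1/q`. -/
def bStar (p q : ℝ≥0∞) (b : ℝ) : ℝ := b + recip p - recip q

/-- The constant `γ_{p,q,b} = (b / (b + 1/p - 1/q)) ^ (1/q - 1/p)`. -/
def gammaConst (p q : ℝ≥0∞) (b : ℝ) : ℝ :=
  (b / bStar p q b) ^ (recip q - recip p)

end EllipsoidEntropy

end

/-! Write `B` for `bStar p q b` and put 1/∞ = 0. Part (i): the threshold condition says 1/q ≥ 1/p +
b. With 1/r = 1/q - 1/p this is br ≤ 1, so ∑ μ_n^r diverges, and the equality case of Hölder's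
inequality gives finitely supported points of the ellipsoid with arbitrarily large ℓ^q norm
(`exists_unbounded_witness`). An unbounded set has no finite cover at any radius.

Lower bound: project to the first d coordinates and compare volumes (`le_log_ncard_of_isCover`).
Stirling's formula turns the volume ratio into d(log K + b - B log d - log ε + o(1)) with K =
Γ_{p,q} c, and d ≈ (K/ε)^(1/B) leaves bd.

Upper bound for q ≤ p: divide the first d coordinates by μ_i/μ_{d+1}. By Hölder the resulting ℓ^q
norm is at most the ℓ^r norm of the semi-axes capped at μ_{d+1}, asymptotically γcd^(-B)
(`eventually_capped_le`). The head is covered by a greedy random-covering argument in the style of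
Rogers (`exists_finset_cover_scaled_ball`), which costs log 2 per dimension plus ∑ log(μ_i/μ_{d+1})
~ bd. The radius of the head balls must be proportional to the head norm, so that head error and
tail together do not exceed the Hölder bound; `metricEntropy_le_of_head_cover` arranges this by
discretizing the head norm.

Upper bound for p < q: round each coordinate toward zero to a multiple of a step t_n tuned by
interpolation between ℓ^p and ℓ^∞. The centers are integer points of a weighted ℓ^1 ball, counted by
an exponential weight (`exists_finset_lattice`). The exponent is a Riemann sum of order ε^(-1/B), so
the bounds of (iii) follow even without their logarithmic factors (`exists_metricEntropy_le`). -/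

namespace EllipsoidEntropy

open MeasureTheory

/-! ### Extended-valued ℓ^q norms of families -/

variable {ι κ : Type*}

/-- The `ℓ^q` norm of a family of real numbers, with values in `[0, ∞]`. -/
noncomputable def seqNorm (q : ℝ≥0∞) (f : ι → ℝ) : ℝ≥0∞ :=
  if q = ∞ then ⨆ n, ‖f n‖ₑ else (∑' n, ‖f n‖ₑ ^ q.toReal) ^ (1 / q.toReal)

lemma seqNorm_top (f : ι → ℝ) : seqNorm ∞ f = ⨆ n, ‖f n‖ₑ := by simp [seqNorm]

lemma seqNorm_of_ne_top {q : ℝ≥0∞} (hq : q ≠ ∞) (f : ι → ℝ) :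
    seqNorm q f = (∑' n, ‖f n‖ₑ ^ q.toReal) ^ (1 / q.toReal) := by simp [seqNorm, hq]

lemma ellipsoidNorm_eq_seqNorm (p : ℝ≥0∞) (μ x : ℕ+ → ℝ) :
    ellipsoidNorm p μ x = seqNorm p (fun n => x n / μ n) := by
  simp only [ellipsoidNorm, seqNorm, Real.enorm_eq_ofReal_abs]

lemma toReal_pos_of_one_le {q : ℝ≥0∞} (h1 : 1 ≤ q) (hq : q ≠ ∞) : 0 < q.toReal :=
  ENNReal.toReal_pos (zero_lt_one.trans_le h1).ne' hq

lemma seqNorm_rpow {q : ℝ≥0∞} (h1 : 1 ≤ q) (hq : q ≠ ∞) (f : ι → ℝ) :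
    seqNorm q f ^ q.toReal = ∑' n, ‖f n‖ₑ ^ q.toReal := by
  have := toReal_pos_of_one_le h1 hq
  rw [seqNorm_of_ne_top hq, ← ENNReal.rpow_mul, one_div_mul_cancel this.ne', ENNReal.rpow_one]

lemma seqNorm_le_iff {q : ℝ≥0∞} (h1 : 1 ≤ q) (hq : q ≠ ∞) (f : ι → ℝ) (C : ℝ≥0∞) :
    seqNorm q f ≤ C ↔ ∑' n, ‖f n‖ₑ ^ q.toReal ≤ C ^ q.toReal := by
  rw [← seqNorm_rpow h1 hq, ENNReal.rpow_le_rpow_iff (toReal_pos_of_one_le h1 hq)]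

lemma seqNorm_mono {q : ℝ≥0∞} {f : ι → ℝ} {g : ι → ℝ} (h : ∀ n, |f n| ≤ |g n|) :
    seqNorm q f ≤ seqNorm q g := by
  have h' : ∀ n, ‖f n‖ₑ ≤ ‖g n‖ₑ := fun n => by
    rw [Real.enorm_eq_ofReal_abs, Real.enorm_eq_ofReal_abs]
    exact ENNReal.ofReal_le_ofReal (h n)
  unfold seqNorm
  split_ifs
  · exact iSup_mono h'
  · gcongr with n
    exact h' n

/-- For the σ-algebra ⊤ every function is measurable, so Hölder and Minkowski carry over from L^q of
the counting measure. -/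
lemma seqNorm_eq_eLpNorm {q : ℝ≥0∞} (h1 : 1 ≤ q) (f : ι → ℝ) :
    seqNorm q f = eLpNorm f q (@Measure.count ι ⊤) := by
  let _ : MeasurableSpace ι := ⊤
  by_cases hq : q = ∞
  · subst hq
    rw [seqNorm_top, eLpNorm_exponent_top, eLpNormEssSup_count]
  · rw [seqNorm_of_ne_top hq, eLpNorm_eq_lintegral_rpow_enorm_toReal (zero_lt_one.trans_le h1).ne' hq,
      lintegral_count]

lemma seqNorm_mul_le {p q r : ℝ≥0∞} (hp : 1 ≤ p) (hq : 1 ≤ q) (hr : 1 ≤ r)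
    (h : p⁻¹ + r⁻¹ = q⁻¹) (f g : ι → ℝ) :
    seqNorm q (fun n => f n * g n) ≤ seqNorm p f * seqNorm r g := by
  let _ : MeasurableSpace ι := ⊤
  have : DiscreteMeasurableSpace ι := ⟨fun _ => trivial⟩
  have : ENNReal.HolderTriple p r q := ⟨h⟩
  rw [seqNorm_eq_eLpNorm hp, seqNorm_eq_eLpNorm hq, seqNorm_eq_eLpNorm hr]
  exact eLpNorm_smul_le_mul_eLpNorm (E := ℝ) (𝕜 := ℝ)
    (Measurable.of_discrete.aestronglyMeasurable) (Measurable.of_discrete.aestronglyMeasurable)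

lemma seqNorm_add_le {q : ℝ≥0∞} (hq : 1 ≤ q) (f g : ι → ℝ) :
    seqNorm q (f + g) ≤ seqNorm q f + seqNorm q g := by
  let _ : MeasurableSpace ι := ⊤
  have : DiscreteMeasurableSpace ι := ⟨fun _ => trivial⟩
  rw [seqNorm_eq_eLpNorm hq, seqNorm_eq_eLpNorm hq, seqNorm_eq_eLpNorm hq]
  exact eLpNorm_add_le (Measurable.of_discrete.aestronglyMeasurable)
    (Measurable.of_discrete.aestronglyMeasurable) hq

lemma seqNorm_const_mul {q : ℝ≥0∞} (hq : 1 ≤ q) (a : ℝ) (f : ι → ℝ) :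
    seqNorm q (fun n => a * f n) = ‖a‖ₑ * seqNorm q f := by
  let _ : MeasurableSpace ι := ⊤
  rw [seqNorm_eq_eLpNorm hq, seqNorm_eq_eLpNorm hq]
  exact eLpNorm_const_smul a f q _

lemma enorm_le_seqNorm {q : ℝ≥0∞} (hq : 1 ≤ q) (f : ι → ℝ) (n : ι) : ‖f n‖ₑ ≤ seqNorm q f := by
  let _ : MeasurableSpace ι := ⊤
  have : DiscreteMeasurableSpace ι := ⟨fun _ => trivial⟩
  rw [seqNorm_eq_eLpNorm hq]
  exact enorm_le_eLpNorm_count f n (zero_lt_one.trans_le hq).ne'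

/-- The norm is unchanged by restriction along an injective map whose range contains the support. -/
lemma seqNorm_comp_injective {q : ℝ≥0∞} (hq : 1 ≤ q) {e : κ → ι} (he : Function.Injective e)
    (f : ι → ℝ) (hf : ∀ n, n ∉ Set.range e → f n = 0) :
    seqNorm q (f ∘ e) = seqNorm q f := by
  by_cases h : q = ∞
  · subst h
    rw [seqNorm_top, seqNorm_top]
    refine le_antisymm (iSup_le fun k => le_iSup (fun n => ‖f n‖ₑ) (e k)) (iSup_le fun n => ?_)
    by_cases hn : n ∈ Set.range e
    · obtain ⟨k, rfl⟩ := hn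
      exact le_iSup (fun k => ‖(f ∘ e) k‖ₑ) k
    · simp [hf n hn]
  · rw [seqNorm_of_ne_top h, seqNorm_of_ne_top h]
    congr 1
    refine he.tsum_eq (f := fun n => ‖f n‖ₑ ^ q.toReal) fun n hn => ?_
    by_contra hn'
    apply hn
    simp [hf n hn', toReal_pos_of_one_le hq h]

lemma seqNorm_comp_le {q : ℝ≥0∞} {e : κ → ι} (he : Function.Injective e)
    (f : ι → ℝ) : seqNorm q (f ∘ e) ≤ seqNorm q f := by
  by_cases h : q = ∞
  · subst h
    rw [seqNorm_top, seqNorm_top]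
    exact iSup_le fun k => le_iSup (fun n => ‖f n‖ₑ) (e k)
  · rw [seqNorm_of_ne_top h, seqNorm_of_ne_top h]
    gcongr
    exact ENNReal.tsum_comp_le_tsum_of_injective he (fun n => ‖f n‖ₑ ^ q.toReal)

lemma seqNorm_eq_norm_toLp [Fintype ι] {q : ℝ≥0∞} [Fact (1 ≤ q)] (y : ι → ℝ) :
    seqNorm q y = ENNReal.ofReal ‖WithLp.toLp q y‖ := by
  by_cases h : q = ∞
  · subst h
    rw [seqNorm_top, ofReal_norm, enorm_eq_nnnorm, PiLp.nnnorm_toLp, Pi.nnnorm_def]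
    refine le_antisymm (iSup_le fun i => ?_) ?_
    · exact ENNReal.coe_le_coe.2 (Finset.le_sup (f := fun b => ‖y b‖₊) (Finset.mem_univ i))
    · rw [ENNReal.coe_finset_sup]
      exact Finset.sup_le fun i _ => le_iSup (fun n => ‖y n‖ₑ) i
  · have hq := toReal_pos_of_one_le Fact.out h
    rw [seqNorm_of_ne_top h, PiLp.norm_eq_sum hq, tsum_fintype,
      ← ENNReal.ofReal_rpow_of_nonneg (by positivity) (by positivity),
      ENNReal.ofReal_sum_of_nonneg (fun _ _ => by positivity)]
    congr 1
    refine Finset.sum_congr rfl fun i _ => ?_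
    rw [← ENNReal.ofReal_rpow_of_nonneg (by positivity) hq.le, ofReal_norm]

lemma memℓp_iff_seqNorm_lt_top {q : ℝ≥0∞} (hq : 1 ≤ q) (f : ι → ℝ) :
    Memℓp f q ↔ seqNorm q f < ∞ := by
  by_cases h : q = ∞
  · subst h
    rw [memℓp_infty_iff, seqNorm_top]
    simp only [enorm_eq_nnnorm]
    rw [ENNReal.iSup_coe_lt_top]
    constructor
    · rintro ⟨C, hC⟩
      exact ⟨C.toNNReal, by
        rintro _ ⟨n, rfl⟩
        exact NNReal.le_toNNReal_of_coe_le (hC ⟨n, rfl⟩)⟩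
    · rintro ⟨C, hC⟩
      exact ⟨C, by
        rintro _ ⟨n, rfl⟩
        exact_mod_cast hC ⟨n, rfl⟩⟩
  · have h0 := toReal_pos_of_one_le hq h
    rw [memℓp_gen_iff h0, seqNorm_of_ne_top h]
    rw [ENNReal.rpow_lt_top_iff_of_pos (by positivity), lt_top_iff_ne_top]
    have : ∀ n, ‖f n‖ₑ ^ q.toReal = ENNReal.ofReal (‖f n‖ ^ q.toReal) := fun n => by
      rw [← ENNReal.ofReal_rpow_of_nonneg (by positivity) h0.le, ofReal_norm]
    simp only [this]
    constructor
    · exact fun hs => hs.tsum_ofReal_ne_top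
    · intro hs
      have := ENNReal.summable_toReal hs
      refine this.congr fun n => ?_
      rw [ENNReal.toReal_ofReal (by positivity)]

lemma lp_enorm_eq_seqNorm {q : ℝ≥0∞} [Fact (1 ≤ q)] (x : lp (fun _ : ι => ℝ) q) :
    ‖x‖ₑ = seqNorm q (x : ι → ℝ) := by
  by_cases h : q = ∞
  · subst h
    rw [seqNorm_top, ← ofReal_norm, lp.norm_eq_ciSup]
    have hb := memℓp_infty_iff.1 (lp.memℓp x)
    refine le_antisymm ?_ (iSup_le fun n => ?_)
    · refine ENNReal.ofReal_le_of_le_toReal (Real.iSup_le (fun i => ?_) ENNReal.toReal_nonneg)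
      have htop : (⨆ n, ‖(x : ι → ℝ) n‖ₑ) ≠ ∞ := by
        rw [← seqNorm_top]
        exact ((memℓp_iff_seqNorm_lt_top le_top _).1 (lp.memℓp x)).ne
      rw [← toReal_enorm]
      exact ENNReal.toReal_mono htop (le_iSup (fun n => ‖(x : ι → ℝ) n‖ₑ) i)
    · rw [← ofReal_norm]
      exact ENNReal.ofReal_le_ofReal (le_ciSup hb n)
  · have h0 : 0 < q.toReal := toReal_pos_of_one_le Fact.out h
    rw [seqNorm_of_ne_top h, ← ofReal_norm, lp.norm_eq_tsum_rpow h0,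
      ← ENNReal.ofReal_rpow_of_nonneg (tsum_nonneg fun _ => by positivity) (by positivity),
      ENNReal.ofReal_tsum_of_nonneg (fun _ => by positivity)
        ((memℓp_gen_iff h0).1 (lp.memℓp x))]
    congr 1
    refine tsum_congr fun i => ?_
    rw [← ENNReal.ofReal_rpow_of_nonneg (by positivity) h0.le, ofReal_norm]

/-! ### Splitting a sequence into head and tail -/

/-- Extension of a vector by zero. -/
def emb {d : ℕ} (y : Fin d → ℝ) : ℕ+ → ℝ :=
  fun n => if h : n.natPred < d then y ⟨n.natPred, h⟩ else 0

/-- The first `d` terms of a sequence. -/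
def hd (d : ℕ) (x : ℕ+ → ℝ) : Fin d → ℝ := fun i => x (i : ℕ).succPNat

/-- The sequence with its first `d` terms replaced by zero. -/
def tl (d : ℕ) (x : ℕ+ → ℝ) : ℕ+ → ℝ := fun n => if n.natPred < d then 0 else x n

lemma emb_hd_add_tl (d : ℕ) (x : ℕ+ → ℝ) : emb (hd d x) + tl d x = x := by
  funext n
  by_cases h : n.natPred < d <;> simp [emb, hd, tl, h]

lemma hd_emb {d : ℕ} (y : Fin d → ℝ) : hd d (emb y) = y := by
  funext n
  simp [emb, hd]

lemma succPNat_injective (d : ℕ) : Function.Injective fun i : Fin d => (i : ℕ).succPNat :=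
  fun _ _ h => Fin.ext (Nat.succPNat_injective h)

lemma seqNorm_emb {q : ℝ≥0∞} [Fact (1 ≤ q)] {d : ℕ} (y : Fin d → ℝ) :
    seqNorm q (emb y) = ENNReal.ofReal ‖WithLp.toLp q y‖ := by
  rw [← seqNorm_eq_norm_toLp, ← seqNorm_comp_injective Fact.out (succPNat_injective d)]
  · congr 1
    exact hd_emb y
  · intro n hn
    have : ¬ n.natPred < d := fun h => hn ⟨⟨n.natPred, h⟩, by simp⟩
    simp [emb, this]

lemma norm_hd_le {q : ℝ≥0∞} [Fact (1 ≤ q)] (d : ℕ) (x : ℕ+ → ℝ) :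
    ENNReal.ofReal ‖WithLp.toLp q (hd d x)‖ ≤ seqNorm q x := by
  rw [← seqNorm_eq_norm_toLp]
  exact seqNorm_comp_le (succPNat_injective d) x

lemma seqNorm_emb_add_tl_rpow {q : ℝ≥0∞} (hq1 : 1 ≤ q) (hq : q ≠ ∞) {d : ℕ} (y : Fin d → ℝ)
    (x : ℕ+ → ℝ) : seqNorm q (emb y + tl d x) ^ q.toReal =
      seqNorm q (emb y) ^ q.toReal + seqNorm q (tl d x) ^ q.toReal := by
  have h0 : 0 < q.toReal := toReal_pos_of_one_le hq1 hq
  rw [seqNorm_rpow hq1 hq, seqNorm_rpow hq1 hq, seqNorm_rpow hq1 hq, ← ENNReal.tsum_add]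
  refine tsum_congr fun n => ?_
  by_cases hn : n.natPred < d <;> simp [emb, tl, hn, h0]

/-- For finite q the q-th powers of head and tail norms add; for q = ∞ their maximum is taken.
Either way only the norm of the head matters, not its shape. -/
lemma seqNorm_emb_add_le {q : ℝ≥0∞} [hq1 : Fact (1 ≤ q)] {d : ℕ} (e h : Fin d → ℝ)
    (heh : ‖WithLp.toLp q e‖ ≤ ‖WithLp.toLp q h‖) (x : ℕ+ → ℝ) :
    seqNorm q (emb e + tl d x) ≤ seqNorm q (emb h + tl d x) := by
  have key : seqNorm q (emb e) ≤ seqNorm q (emb h) := by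
    rw [seqNorm_emb, seqNorm_emb]
    exact ENNReal.ofReal_le_ofReal heh
  by_cases hq : q = ∞
  · subst hq
    have h1 : seqNorm ∞ (emb h) ≤ seqNorm ∞ (emb h + tl d x) := seqNorm_mono fun n => by
      by_cases hn : n.natPred < d <;> simp [emb, tl, hn]
    have h2 : seqNorm ∞ (tl d x) ≤ seqNorm ∞ (emb h + tl d x) := seqNorm_mono fun n => by
      by_cases hn : n.natPred < d <;> simp [emb, tl, hn]
    rw [seqNorm_top]
    refine iSup_le fun n => ?_
    by_cases hn : n.natPred < d
    · refine le_trans ?_ ((enorm_le_seqNorm hq1.out (emb e) n).trans (key.trans h1))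
      simp [emb, tl, hn]
    · refine le_trans ?_ ((enorm_le_seqNorm hq1.out (tl d x) n).trans h2)
      simp [emb, tl, hn]
  · have h0 : 0 < q.toReal := toReal_pos_of_one_le hq1.out hq
    rw [← ENNReal.rpow_le_rpow_iff h0, seqNorm_emb_add_tl_rpow hq1.out hq,
      seqNorm_emb_add_tl_rpow hq1.out hq]
    gcongr

/-! ### Entropy bounds from finite covers -/

section Entropy

variable {X : Type*} [PseudoEMetricSpace X]

lemma metricEntropy_le {ε : ℝ} {A C : Set X} {N : ℝ} (hN : 1 ≤ N)
    (hC : Metric.IsCover ε.toNNReal A C) (hfin : C.Finite) (hcard : (C.ncard : ℝ) ≤ N) :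
    metricEntropy ε A ≤ ((Real.log N / Real.log 2 : ℝ) : EReal) := by
  have h1 := hC.externalCoveringNumber_le_encard
  have h2 : ((Metric.externalCoveringNumber ε.toNNReal A : ℕ∞) : ℝ≥0∞) ≤ ENNReal.ofReal N := by
    refine (ENat.toENNReal_le.2 h1).trans ?_
    rw [← hfin.cast_ncard_eq]
    simp only [ENat.toENNReal_coe]
    rw [← ENNReal.ofReal_natCast]
    exact ENNReal.ofReal_le_ofReal hcard
  have h3 := ENNReal.log_le_log h2
  rw [ENNReal.log_ofReal_of_pos (by linarith)] at h3
  unfold metricEntropy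
  rw [EReal.coe_div]
  exact EReal.div_le_div_right_of_nonneg (by exact_mod_cast (Real.log_pos one_lt_two).le) h3

/-- A minimal cover exists because ℕ∞ is well-ordered, and only finite ones matter since otherwise
the entropy is ⊤. Nonemptiness of `A` makes the cardinality positive, so that the real and the
extended logarithm agree. -/
lemma le_metricEntropy {ε : ℝ} {A : Set X} {K : ℝ} (hA : A.Nonempty)
    (h : ∀ C : Set X, C.Finite → Metric.IsCover ε.toNNReal A C → K ≤ Real.log C.ncard) :
    ((K / Real.log 2 : ℝ) : EReal) ≤ metricEntropy ε A := by
  unfold metricEntropy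
  rw [EReal.coe_div]
  refine EReal.div_le_div_right_of_nonneg (by exact_mod_cast (Real.log_pos one_lt_two).le) ?_
  by_cases htop : Metric.externalCoveringNumber ε.toNNReal A = ⊤
  · simp [htop]
  · obtain ⟨C, hC, hcard⟩ : ∃ C : Set X, Metric.IsCover ε.toNNReal A C ∧
        C.encard = Metric.externalCoveringNumber ε.toNNReal A := by
      have : Nonempty {C : Set X // Metric.IsCover ε.toNNReal A C} := ⟨A, .refl _ _⟩
      obtain ⟨C, hC⟩ := ENat.exists_eq_iInf
        (fun C : {C : Set X // Metric.IsCover ε.toNNReal A C} => (C : Set X).encard)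
      exact ⟨C, C.2, by rw [hC, iInf_subtype]; rfl⟩
    have hfin : C.Finite := by
      rw [← Set.encard_ne_top_iff, hcard]; exact htop
    have hne : C.Nonempty := hC.nonempty hA
    have h0 : 0 < (C.ncard : ℝ) := by exact_mod_cast (Set.ncard_pos hfin).2 hne
    rw [← hcard, ← hfin.cast_ncard_eq]
    simp only [ENat.toENNReal_coe]
    rw [← ENNReal.ofReal_natCast, ENNReal.log_ofReal_of_pos h0]
    exact_mod_cast h C hfin hC

lemma metricEntropy_eq_top {ε : ℝ} {A : Set X}
    (h : ∀ C : Set X, C.Finite → ¬ Metric.IsCover ε.toNNReal A C) : metricEntropy ε A = ⊤ := by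
  unfold metricEntropy
  have : Metric.externalCoveringNumber ε.toNNReal A = ⊤ := by
    unfold Metric.externalCoveringNumber
    simp only [iInf_eq_top, Set.encard_eq_top_iff]
    exact fun C hC hfin => h C hfin hC
  rw [this]
  simp only [ENat.toENNReal_top, ENNReal.log_top]
  exact EReal.top_div_of_pos_ne_top (by exact_mod_cast Real.log_pos one_lt_two) (EReal.coe_ne_top _)

end Entropy

lemma isCover_iff {X : Type*} [PseudoEMetricSpace X] {ε : ℝ≥0} {A C : Set X} :
    Metric.IsCover ε A C ↔ ∀ x ∈ A, ∃ y ∈ C, edist x y ≤ ε := Iff.rfl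

lemma lp_edist_eq {q : ℝ≥0∞} [Fact (1 ≤ q)] (x y : lp (fun _ : ι => ℝ) q) :
    edist x y = seqNorm q ((x : ι → ℝ) - (y : ι → ℝ)) := by
  rw [edist_eq_enorm_sub, lp_enorm_eq_seqNorm, lp.coeFn_sub]

/-! ### Exponents, threshold and semi-axes -/

lemma recip_eq_inv (p : ℝ≥0∞) : recip p = p.toReal⁻¹ := ENNReal.toReal_inv p

lemma recip_nonneg (p : ℝ≥0∞) : 0 ≤ recip p := ENNReal.toReal_nonneg

lemma recip_top : recip ∞ = 0 := by simp [recip]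

lemma recip_lt_recip {p q : ℝ≥0∞} (h1 : 1 ≤ p) (h : p < q) : recip q < recip p :=
  (ENNReal.toReal_lt_toReal (ENNReal.inv_ne_top.2 (zero_lt_one.trans_le (h1.trans h.le)).ne')
    (ENNReal.inv_ne_top.2 (zero_lt_one.trans_le h1).ne')).2 (ENNReal.inv_lt_inv.2 h)

lemma threshold_eq {p : ℝ≥0∞} (h1 : 1 ≤ p) (b : ℝ) :
    threshold p b = ENNReal.ofReal (1 / (recip p + b)) := by
  by_cases h : p = ∞
  · subst h; simp [threshold, recip]
  · have := toReal_pos_of_one_le h1 h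
    rw [threshold, if_neg h, recip_eq_inv]
    congr 1
    field_simp
    ring_nf

/-- In terms of reciprocals the threshold is a linear condition; q = ∞ is excluded because the
threshold is finite. -/
lemma le_threshold_iff {p q : ℝ≥0∞} {b : ℝ} (hp : 1 ≤ p) (hq : 1 ≤ q) (hb : 0 < b) :
    q ≤ threshold p b ↔ q ≠ ∞ ∧ recip p + b ≤ recip q := by
  have h0 : 0 < recip p + b := by have := recip_nonneg p; linarith
  rw [threshold_eq hp]
  by_cases h : q = ∞
  · simp [h]
  · have hq0 := toReal_pos_of_one_le hq h
    rw [recip_eq_inv q, ← ENNReal.ofReal_toReal h, ENNReal.ofReal_le_ofReal_iff (by positivity),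
      ENNReal.toReal_ofReal hq0.le, le_div_iff₀ h0, ← one_div, le_div_iff₀ hq0, mul_comm]
    simp

lemma bStar_pos_of_threshold_lt {p q : ℝ≥0∞} {b : ℝ} (hp : 1 ≤ p) (hq : 1 ≤ q) (hb : 0 < b)
    (h : threshold p b < q) : 0 < bStar p q b := by
  have h' := (le_threshold_iff hp hq hb).not.1 h.not_ge
  unfold bStar
  by_cases ht : q = ∞
  · have := recip_nonneg p
    simp only [ht, recip_top]
    linarith
  · by_contra hc
    exact h' ⟨ht, by linarith⟩

lemma tendsto_semiaxis {b c : ℝ} {μ : ℕ+ → ℝ}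
    (hμ : (fun n : ℕ+ => μ n - c / (n : ℝ) ^ b) =o[atTop] fun n : ℕ+ => 1 / (n : ℝ) ^ b) :
    Tendsto (fun i : ℕ => μ i.succPNat * ((i : ℝ) + 1) ^ b) atTop (𝓝 c) := by
  have h1 : Tendsto Nat.succPNat atTop atTop := by
    refine tendsto_atTop.2 fun n => ?_
    filter_upwards [eventually_ge_atTop (n : ℕ)] with i hi
    rw [← PNat.coe_le_coe, Nat.succPNat_coe]
    omega
  have h2 := (hμ.comp_tendsto h1).tendsto_div_nhds_zero
  have h3 := h2.add_const c
  rw [zero_add] at h3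
  refine h3.congr fun i => ?_
  have : (0 : ℝ) < ((i : ℝ) + 1) ^ b := by positivity
  simp only [Function.comp, Nat.succPNat_coe, Nat.succ_eq_add_one]
  push_cast
  field_simp
  ring

lemma mem_ellipsoid_iff {p : ℝ≥0∞} {μ x : ℕ+ → ℝ} :
    x ∈ ellipsoid p μ ↔ Memℓp x p ∧ seqNorm p (fun n => x n / μ n) ≤ 1 := by
  rw [← ellipsoidNorm_eq_seqNorm]; rfl

lemma memℓp_emb {q : ℝ≥0∞} [Fact (1 ≤ q)] {d : ℕ} (y : Fin d → ℝ) : Memℓp (emb y) q := by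
  rw [memℓp_iff_seqNorm_lt_top Fact.out, seqNorm_emb]
  exact ENNReal.ofReal_lt_top

lemma emb_mem_ellipsoid {p : ℝ≥0∞} [Fact (1 ≤ p)] {μ : ℕ+ → ℝ} {d : ℕ} {y : Fin d → ℝ}
    (h : ‖WithLp.toLp p (fun i : Fin d => y i / μ (i : ℕ).succPNat)‖ ≤ 1) :
    emb y ∈ ellipsoid p μ := by
  refine mem_ellipsoid_iff.2 ⟨memℓp_emb y, ?_⟩
  have : (fun n => emb y n / μ n) = emb (fun i : Fin d => y i / μ (i : ℕ).succPNat) := by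
    funext n
    by_cases hn : n.natPred < d <;> simp [emb, hn]
  rw [this, seqNorm_emb]
  exact ENNReal.ofReal_le_one.2 h

/-! ### Unboundedness at or below the threshold -/

/-- Equality case of Hölder with 1/r = 1/q - 1/p: the point y_i = a_i^(1 + r/p) S^(-1/p), where S =
∑ a_i^r, has (y_i/a_i)^p = a_i^r / S for finite p. -/
lemma exists_unbounded_witness {p q : ℝ≥0∞} [Fact (1 ≤ p)] [Fact (1 ≤ q)] (hq : q ≠ ∞)
    {d : ℕ} {a : Fin d → ℝ} (ha : ∀ i, 0 < a i) (hd : 0 < d) (hpq : recip p < recip q) :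
    ∃ y : Fin d → ℝ, ‖WithLp.toLp p (fun i => y i / a i)‖ ≤ 1 ∧
      ‖WithLp.toLp q y‖ = (∑ i, a i ^ (1 / (recip q - recip p))) ^ (recip q - recip p) := by
  set r := 1 / (recip q - recip p) with hr
  set P := recip p with hP
  set S := ∑ i, a i ^ r with hS
  have : Nonempty (Fin d) := ⟨⟨0, hd⟩⟩
  have hS0 : 0 < S := Finset.sum_pos (fun i _ => Real.rpow_pos_of_pos (ha i) _)
    Finset.univ_nonempty
  have hquot : ∀ i, a i ^ (1 + r * P) * S ^ (-P) / a i = a i ^ (r * P) * S ^ (-P) := fun i => by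
    rw [Real.rpow_add (ha i), Real.rpow_one]
    field_simp [(ha i).ne']
  refine ⟨fun i => a i ^ (1 + r * P) * S ^ (-P), ?_, ?_⟩
  · simp only [hquot]
    by_cases hp : p = ∞
    · have hP0 : P = 0 := by rw [hP, hp, recip_top]
      subst hp
      rw [PiLp.norm_eq_ciSup]
      refine Real.iSup_le (fun i => ?_) zero_le_one
      simp [hP0]
    · have hp0 : 0 < p.toReal := toReal_pos_of_one_le Fact.out hp
      have hPp : P * p.toReal = 1 := by rw [hP, recip_eq_inv, inv_mul_cancel₀ hp0.ne']
      rw [PiLp.norm_eq_sum hp0]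
      refine Real.rpow_le_one (Finset.sum_nonneg fun i _ => by positivity) ?_ (by positivity)
      have : ∀ i, ‖a i ^ (r * P) * S ^ (-P)‖ ^ p.toReal = a i ^ r * S⁻¹ := fun i => by
        have := ha i
        rw [Real.norm_of_nonneg (by positivity), Real.mul_rpow (by positivity) (by positivity),
          ← Real.rpow_mul (ha i).le, ← Real.rpow_mul hS0.le, mul_assoc, hPp, mul_one, neg_mul, hPp,
          Real.rpow_neg_one]
      simp only [this]
      rw [← Finset.sum_mul, ← hS, mul_inv_cancel₀ hS0.ne']
  · have hq0 : 0 < q.toReal := toReal_pos_of_one_le Fact.out hq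
    have hQ : recip q = q.toReal⁻¹ := recip_eq_inv q
    have hne : q.toReal⁻¹ - P ≠ 0 := by rw [← hQ]; linarith
    -- From r(1/q - 1/p) = 1 one gets 1 + r/p = r/q, so the q-th powers of the y_i are again
    -- proportional to a_i^r.
    have hexp : (1 + r * P) * q.toReal = r := by
      have h1 : r * (recip q - P) = 1 := by rw [hr, one_div_mul_cancel (by rw [hQ]; exact hne)]
      rw [show 1 + r * P = r * q.toReal⁻¹ by rw [← hQ]; linarith, mul_assoc,
        inv_mul_cancel₀ hq0.ne', mul_one]
    rw [PiLp.norm_eq_sum hq0]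
    have : ∀ i, ‖a i ^ (1 + r * P) * S ^ (-P)‖ ^ q.toReal = a i ^ r * S ^ (-P * q.toReal) :=
      fun i => by
        have := ha i
        rw [Real.norm_of_nonneg (by positivity), Real.mul_rpow (by positivity) (by positivity),
          ← Real.rpow_mul (ha i).le, ← Real.rpow_mul hS0.le, hexp]
    simp only [this]
    rw [← Finset.sum_mul, ← hS]
    nth_rw 1 [← Real.rpow_one S]
    rw [← Real.rpow_add hS0, ← Real.rpow_mul hS0.le, hQ]
    congr 1
    field_simp
    ring

lemma tendsto_sum_semiaxis_rpow {b c r : ℝ} {μ : ℕ+ → ℝ} (hc : 0 < c) (hr : 0 < r)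
    (hbr : b * r ≤ 1) (hpos : ∀ n, 0 < μ n)
    (hμ : Tendsto (fun i : ℕ => μ i.succPNat * ((i : ℝ) + 1) ^ b) atTop (𝓝 c)) :
    Tendsto (fun d : ℕ => ∑ i : Fin d, μ (i : ℕ).succPNat ^ r) atTop atTop := by
  have hsum : ¬ Summable fun i : ℕ => μ i.succPNat ^ r := by
    intro hs
    have hO : (fun i : ℕ => 1 / ((i + 1 : ℕ) : ℝ) ^ (b * r)) =O[atTop]
        fun i : ℕ => μ i.succPNat ^ r := by
      -- Eventually μ_n n^b > c/2, so n^(-br) is dominated by a multiple of μ_n^r; the former is not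
      -- summable for br ≤ 1.
      refine IsBigO.of_bound ((c / 2) ^ (-r)) ?_
      filter_upwards [hμ.eventually (lt_mem_nhds (half_lt_self hc))] with i hi
      have h1 : (0 : ℝ) < ((i : ℝ) + 1) ^ b := by positivity
      have h2 := hpos i.succPNat
      rw [Real.norm_of_nonneg (by positivity), Real.norm_of_nonneg (by positivity)]
      push_cast
      have h3 := Real.rpow_le_rpow (by positivity) hi.le hr.le
      rw [Real.mul_rpow h2.le h1.le, ← Real.rpow_mul (by positivity)] at h3
      rw [Real.rpow_neg (by positivity), inv_mul_eq_div, div_le_div_iff₀ (by positivity)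
        (by positivity), one_mul]
      exact h3
    have := summable_of_isBigO_nat hs hO
    rw [summable_nat_add_iff (f := fun i : ℕ => 1 / (i : ℝ) ^ (b * r)) 1,
      Real.summable_one_div_nat_rpow] at this
    linarith
  have := (not_summable_iff_tendsto_nat_atTop_of_nonneg
    (fun i => (Real.rpow_pos_of_pos (hpos _) _).le)).1 hsum
  refine this.congr fun d => ?_
  rw [Finset.sum_range]

lemma not_isBounded_of_le_threshold {p q : ℝ≥0∞} [Fact (1 ≤ p)] [Fact (1 ≤ q)] {b c : ℝ}
    (hb : 0 < b) (hc : 0 < c) {μ : ℕ+ → ℝ} (hpos : ∀ n, 0 < μ n)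
    (hμ : Tendsto (fun i : ℕ => μ i.succPNat * ((i : ℝ) + 1) ^ b) atTop (𝓝 c))
    (h : q ≤ threshold p b) : ¬ Bornology.IsBounded (ellipsoidIn p q μ) := by
  obtain ⟨hq, hle⟩ := (le_threshold_iff Fact.out Fact.out hb).1 h
  have hlt : 0 < recip q - recip p := by linarith
  intro hbd
  obtain ⟨R, hR⟩ := hbd.exists_norm_le
  have hS := (tendsto_rpow_atTop hlt).comp (tendsto_sum_semiaxis_rpow (r := 1 / (recip q - recip p))
    hc (by positivity) (by rw [mul_one_div, div_le_one hlt]; linarith) hpos hμ)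
  obtain ⟨d, hd, hdpos⟩ := ((hS.eventually_gt_atTop R).and (eventually_gt_atTop 0)).exists
  obtain ⟨y, hy1, hy2⟩ := exists_unbounded_witness (p := p) (q := q) hq
    (fun i : Fin d => hpos (i : ℕ).succPNat) hdpos (by linarith)
  have hx := hR ⟨emb y, memℓp_emb y⟩ (emb_mem_ellipsoid hy1)
  have h1 : ENNReal.ofReal ‖WithLp.toLp q y‖ ≤ ENNReal.ofReal R := by
    rw [← seqNorm_emb]
    refine le_trans ?_ (ENNReal.ofReal_le_ofReal hx)
    rw [ofReal_norm, lp_enorm_eq_seqNorm]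
  have hR0 : 0 ≤ R := (norm_nonneg _).trans hx
  rw [ENNReal.ofReal_le_ofReal_iff hR0, hy2] at h1
  exact absurd hd (not_lt.2 h1)

lemma metricEntropy_eq_top_of_not_isBounded {q : ℝ≥0∞} [Fact (1 ≤ q)]
    {A : Set (lp (fun _ : ℕ+ => ℝ) q)} (hA : ¬ Bornology.IsBounded A) (ε : ℝ) :
    metricEntropy ε A = ⊤ := by
  refine metricEntropy_eq_top fun C hfin hC => hA ?_
  have hsub : A ⊆ ⋃ y ∈ C, Metric.closedBall y ε.toNNReal := fun x hx => by
    obtain ⟨y, hy, hxy⟩ := hC hx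
    refine Set.mem_biUnion hy ?_
    rw [Metric.mem_closedBall, dist_edist]
    exact ENNReal.toReal_le_of_le_ofReal (by positivity) (by rw [ENNReal.ofReal_coe_nnreal]; exact hxy)
  exact ((Bornology.isBounded_biUnion hfin).2 fun y _ => Metric.isBounded_closedBall).subset hsub

/-! ### Lattice points in weighted ℓ^1 balls and Riemann sums -/

section Counting

lemma sum_exp_neg_abs_le {y : ℝ} (hy : 0 < y) (s : Finset ℤ) :
    ∑ k ∈ s, Real.exp (-(y * |(k : ℝ)|)) ≤ 1 + 2 / (Real.exp y - 1) := by
  have hx1 : Real.exp (-y) < 1 := by simpa using hy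
  have hx0 := Real.exp_pos (-y)
  have hgeo : HasSum (fun n : ℕ => Real.exp (-(y * |((n + 1 : ℤ) : ℝ)|)))
      (Real.exp (-y) * (1 - Real.exp (-y))⁻¹) := by
    refine ((hasSum_geometric_of_lt_one hx0.le hx1).mul_left (Real.exp (-y))).congr_fun ?_
    intro n
    rw [← pow_succ', ← Real.exp_nat_mul]
    congr 1
    have : |((n + 1 : ℤ) : ℝ)| = n + 1 := by push_cast; exact abs_of_nonneg (by positivity)
    rw [this]; push_cast; ring
  have hgeo' : HasSum (fun n : ℕ => Real.exp (-(y * |((-(n + 1 : ℤ) : ℤ) : ℝ)|)))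
      (Real.exp (-y) * (1 - Real.exp (-y))⁻¹) := by
    refine hgeo.congr_fun fun n => ?_
    rw [Int.cast_neg, abs_neg]
  have := HasSum.of_add_one_of_neg_add_one (f := fun k : ℤ => Real.exp (-(y * |(k : ℝ)|)))
    hgeo hgeo'
  refine (sum_le_hasSum s (fun k _ => (Real.exp_pos _).le) this).trans (le_of_eq ?_)
  have h1 : Real.exp (-y) * (1 - Real.exp (-y))⁻¹ = 1 / (Real.exp y - 1) := by
    have : Real.exp y - 1 ≠ 0 := by
      have := Real.one_lt_exp_iff.2 hy
      linarith
    have h2 : 1 - Real.exp (-y) ≠ 0 := by linarith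
    rw [Real.exp_neg] at *
    field_simp
  rw [h1]
  simp
  ring

/-- The number of integer points in a weighted `ℓ^1` ball, bounded by an exponential weight. -/
lemma exists_finset_lattice {d : ℕ} {a : Fin d → ℝ} (ha : ∀ i, 0 < a i) {l : ℝ} (hl : 0 < l) :
    ∃ T : Finset (Fin d → ℤ), (∀ k : Fin d → ℤ, ∑ i, a i * |(k i : ℝ)| ≤ 1 → k ∈ T) ∧
      (T.card : ℝ) ≤ Real.exp (l + ∑ i, Real.log (1 + 2 / (Real.exp (l * a i) - 1))) := by
  classical
  -- Each term a_i|k_i| is at most 1, so the ball lies in this finite box.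
  let B : Fin d → Finset ℤ := fun i => Finset.Icc (-⌈1 / a i⌉) ⌈1 / a i⌉
  refine ⟨(Fintype.piFinset B).filter fun k => ∑ i, a i * |(k i : ℝ)| ≤ 1, fun k hk => ?_, ?_⟩
  · refine Finset.mem_filter.2 ⟨Fintype.mem_piFinset.2 fun i => ?_, hk⟩
    have h1 : a i * |(k i : ℝ)| ≤ 1 := (Finset.single_le_sum (f := fun i => a i * |(k i : ℝ)|)
      (fun j _ => mul_nonneg (ha j).le (abs_nonneg _)) (Finset.mem_univ i)).trans hk
    have h2 : |(k i : ℝ)| ≤ 1 / a i := by rw [le_div_iff₀ (ha i), mul_comm]; exact h1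
    have h3 : ((|k i| : ℤ) : ℝ) ≤ (⌈1 / a i⌉ : ℤ) := by
      rw [Int.cast_abs]; exact h2.trans (Int.le_ceil _)
    exact Finset.mem_Icc.2 (abs_le.1 (by exact_mod_cast h3))
  · have hpos : ∀ i, 0 < 1 + 2 / (Real.exp (l * a i) - 1) := fun i => by
      have := Real.one_lt_exp_iff.2 (mul_pos hl (ha i))
      have : 0 < Real.exp (l * a i) - 1 := by linarith
      positivity
    rw [Real.exp_add, Real.exp_sum]
    simp only [Real.exp_log (hpos _)]
    calc (((Fintype.piFinset B).filter fun k => ∑ i, a i * |(k i : ℝ)| ≤ 1).card : ℝ)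
        = ∑ k ∈ (Fintype.piFinset B).filter fun k => ∑ i, a i * |(k i : ℝ)| ≤ 1, (1 : ℝ) := by simp
      -- Chernoff-type bound: a point of the ball has weight exp(l - l ∑ a_i|k_i|) ≥ 1. Summed over
      -- the whole box, the weight factorizes into geometric series.
      _ ≤ ∑ k ∈ (Fintype.piFinset B).filter fun k => ∑ i, a i * |(k i : ℝ)| ≤ 1,
            Real.exp l * ∏ i, Real.exp (-(l * a i * |(k i : ℝ)|)) := by
          refine Finset.sum_le_sum fun k hk => ?_
          rw [← Real.exp_sum, ← Real.exp_add]
          refine Real.one_le_exp ?_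
          rw [Finset.sum_neg_distrib]
          simp only [mul_assoc]
          rw [← Finset.mul_sum]
          have := mul_le_mul_of_nonneg_left (Finset.mem_filter.1 hk).2 hl.le
          linarith
      _ ≤ ∑ k ∈ Fintype.piFinset B, Real.exp l * ∏ i, Real.exp (-(l * a i * |(k i : ℝ)|)) :=
          Finset.sum_le_sum_of_subset_of_nonneg (Finset.filter_subset _ _)
            fun _ _ _ => by positivity
      _ = Real.exp l * ∏ i, ∑ k ∈ B i, Real.exp (-(l * a i * |(k : ℝ)|)) := by
          rw [← Finset.mul_sum, Finset.prod_univ_sum]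
      _ ≤ Real.exp l * ∏ i, (1 + 2 / (Real.exp (l * a i) - 1)) := by
          gcongr with i
          exact sum_exp_neg_abs_le (mul_pos hl (ha i)) _

/-- The left side is logarithmic at 0 and exponentially small at ∞, so every negative power
dominates it. Concretely e^y - 1 ≥ y^N/N!, and log(1 + x) ≤ x^θ/θ for 0 < θ ≤ 1, applied with θ =
τ/N. -/
lemma exists_log_one_add_le {τ : ℝ} (hτ : 0 < τ) :
    ∃ C : ℝ, 0 < C ∧ ∀ y : ℝ, 0 < y → Real.log (1 + 2 / (Real.exp y - 1)) ≤ C * y ^ (-τ) := by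
  set N := ⌈τ⌉₊ with hN
  have hN0 : 0 < N := Nat.ceil_pos.2 hτ
  have hN0' : (0 : ℝ) < N := by exact_mod_cast hN0
  set θ := τ / N with hθ
  have hθ0 : 0 < θ := by positivity
  have hθ1 : θ ≤ 1 := by rw [hθ, div_le_one hN0']; exact Nat.le_ceil τ
  refine ⟨1 / θ * (2 * N.factorial) ^ θ, by positivity, fun y hy => ?_⟩
  have hexp : y ^ N / N.factorial ≤ Real.exp y - 1 := by
    have := Real.sum_le_exp_of_nonneg hy.le (N + 1)
    rw [Finset.sum_range_succ] at this
    have h0 : (1 : ℝ) ≤ ∑ i ∈ Finset.range N, y ^ i / i.factorial := by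
      simpa using Finset.single_le_sum (f := fun i : ℕ => y ^ i / (i.factorial : ℝ))
        (fun i _ => by positivity) (Finset.mem_range.2 hN0)
    linarith
  have hy0 : 0 < y ^ N / N.factorial := by positivity
  set x := 2 / (Real.exp y - 1) with hx
  have hx0 : 0 < x := by have : 0 < Real.exp y - 1 := hy0.trans_le hexp
                         positivity
  have hxle : x ≤ 2 * N.factorial / y ^ N := by
    refine (div_le_div_of_nonneg_left zero_le_two hy0 hexp).trans (le_of_eq ?_)
    field_simp
  have h1 : 1 + x ≤ (1 + x ^ θ) ^ (1 / θ) := by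
    have h : (1 + x) ^ θ ≤ 1 + x ^ θ := by
      simpa using Real.rpow_add_le_add_rpow zero_le_one hx0.le hθ0.le hθ1
    calc 1 + x = ((1 + x) ^ θ) ^ (1 / θ) := by
          rw [← Real.rpow_mul (by positivity), mul_one_div_cancel hθ0.ne', Real.rpow_one]
      _ ≤ _ := by gcongr
  calc Real.log (1 + x) ≤ Real.log ((1 + x ^ θ) ^ (1 / θ)) :=
        Real.log_le_log (by positivity) h1
    _ = 1 / θ * Real.log (1 + x ^ θ) := Real.log_rpow (by positivity) _
    _ ≤ 1 / θ * x ^ θ := by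
        gcongr
        have := Real.log_le_sub_one_of_pos (show 0 < 1 + x ^ θ by positivity)
        linarith
    _ ≤ 1 / θ * (2 * N.factorial / y ^ N) ^ θ := by gcongr
    _ = 1 / θ * (2 * N.factorial) ^ θ * y ^ (-τ) := by
        rw [Real.div_rpow (by positivity) (by positivity), ← Real.rpow_natCast, ← Real.rpow_mul hy.le,
          hθ, mul_div_cancel₀ _ hN0'.ne', Real.rpow_neg hy.le]
        ring

/-- Each term is at most 2(√(K+1) - √K), which telescopes. -/
lemma sum_inv_sqrt_le (K : ℕ) : ∑ i ∈ Finset.range K, ((i : ℝ) + 1) ^ (-(1 / 2) : ℝ) ≤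
    2 * Real.sqrt K := by
  induction K with
  | zero => simp
  | succ K ih =>
    rw [Finset.sum_range_succ]
    have h0 : (0 : ℝ) < (K : ℝ) + 1 := by positivity
    have h : ((K : ℝ) + 1) ^ (-(1 / 2) : ℝ) ≤ 2 * (Real.sqrt (K + 1) - Real.sqrt K) := by
      rw [Real.rpow_neg h0.le, ← Real.sqrt_eq_rpow]
      have h1 := Real.sqrt_pos.2 h0
      have h2 := Real.sq_sqrt h0.le
      have h3 := Real.sq_sqrt (show (0 : ℝ) ≤ K by positivity)
      rw [inv_eq_one_div, div_le_iff₀ h1]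
      nlinarith [sq_nonneg (Real.sqrt (K + 1) - Real.sqrt K), Real.sqrt_nonneg (K : ℝ)]
    push_cast
    linarith

/-- A Riemann-sum bound: a function of `n / l` with an integrable singularity at `0` and integrable
decay at `∞`, summed over `n`, is `O(l)`. -/
lemma sum_le_of_decay {C l : ℝ} (hC : 0 ≤ C) (hl : 1 ≤ l) (f : ℕ → ℝ)
    (h1 : ∀ i : ℕ, f i ≤ C * (((i : ℝ) + 1) / l) ^ (-(1 / 2) : ℝ))
    (h2 : ∀ i : ℕ, f i ≤ C * (((i : ℝ) + 1) / l) ^ (-2 : ℝ)) (hf : ∀ i, 0 ≤ f i) (d : ℕ) :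
    ∑ i ∈ Finset.range d, f i ≤ 4 * C * l := by
  have hl0 : 0 < l := by linarith
  -- Split at index l: the exponent -1/2 is summable enough below, the exponent -2 above.
  set K := ⌊l⌋₊ with hK
  have hK1 : 1 ≤ K := Nat.le_floor (by simpa using hl)
  have hK1' : (1 : ℝ) ≤ K := by exact_mod_cast hK1
  have hKl : (K : ℝ) ≤ l := Nat.floor_le hl0.le
  have hlK : l ≤ 2 * K := by have := Nat.lt_floor_add_one l; rw [← hK] at this; linarith
  have hA : ∑ i ∈ Finset.range K, f i ≤ 2 * C * l := by
    calc ∑ i ∈ Finset.range K, f i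
        ≤ ∑ i ∈ Finset.range K, C * Real.sqrt l * ((i : ℝ) + 1) ^ (-(1 / 2) : ℝ) := by
          refine Finset.sum_le_sum fun i _ => (h1 i).trans (le_of_eq ?_)
          rw [Real.div_rpow (by positivity) hl0.le, Real.rpow_neg hl0.le, ← Real.sqrt_eq_rpow,
            div_inv_eq_mul]
          ring
      _ ≤ C * Real.sqrt l * (2 * Real.sqrt l) := by
          rw [← Finset.mul_sum]
          gcongr
          exact (sum_inv_sqrt_le K).trans (by gcongr)
      _ = 2 * C * l := by linear_combination 2 * C * Real.mul_self_sqrt hl0.le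
  -- The upper limit `max K d` covers the case d < K, where the terms added are nonnegative.
  have hB : ∑ i ∈ Finset.Ico K (max K d), f i ≤ 2 * C * l := by
    calc ∑ i ∈ Finset.Ico K (max K d), f i
        ≤ ∑ i ∈ Finset.Ico K (max K d), C * l ^ 2 * (((i + 1 : ℕ) : ℝ) ^ 2)⁻¹ := by
          refine Finset.sum_le_sum fun i _ => (h2 i).trans (le_of_eq ?_)
          rw [Real.rpow_neg (by positivity)]
          norm_cast
          rw [div_pow, inv_div]
          push_cast
          ring
      _ = C * l ^ 2 * ∑ i ∈ Finset.Ioc K (max K d), ((i : ℝ) ^ 2)⁻¹ := by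
          rw [← Finset.mul_sum]
          congr 1
          rw [Finset.sum_Ico_add' (fun i : ℕ => ((i : ℝ) ^ 2)⁻¹) K (max K d) 1]
          refine Finset.sum_congr ?_ fun _ _ => rfl
          ext i
          simp only [Finset.mem_Ico, Finset.mem_Ioc]
          omega
      _ ≤ C * l ^ 2 * (1 / K) := by
          gcongr
          refine (sum_Ioc_inv_sq_le_sub (by omega) (le_max_left _ _)).trans ?_
          rw [one_div]
          have : (0 : ℝ) ≤ ((max K d : ℕ) : ℝ)⁻¹ := by positivity
          linarith
      _ ≤ 2 * C * l := by
          rw [mul_one_div, div_le_iff₀ (by linarith)]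
          nlinarith [mul_nonneg hC hl0.le]
  calc ∑ i ∈ Finset.range d, f i ≤ ∑ i ∈ Finset.range (max K d), f i :=
        Finset.sum_le_sum_of_subset_of_nonneg (Finset.range_mono (le_max_right _ _))
          fun i _ _ => hf i
    _ = ∑ i ∈ Finset.range K, f i + ∑ i ∈ Finset.Ico K (max K d), f i :=
        (Finset.sum_range_add_sum_Ico _ (le_max_left _ _)).symm
    _ ≤ 4 * C * l := by linarith

end Counting

/-! ### Upper bound for p < q by coordinatewise rounding -/

/-- Rounding toward zero: unlike nearest rounding it never increases the absolute value, and its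
error is bounded by both 1 and |y|, as the interpolation step needs. -/
lemma exists_truncation (y : ℝ) : ∃ k : ℤ, |(k : ℝ)| ≤ |y| ∧ |y - k| ≤ 1 ∧ |y - k| ≤ |y| := by
  rcases le_total 0 y with hy | hy
  · have h1 := Int.floor_le y
    have h2 := Int.lt_floor_add_one y
    have h3 : (0 : ℝ) ≤ (⌊y⌋ : ℤ) := by exact_mod_cast Int.floor_nonneg.2 hy
    refine ⟨⌊y⌋, ?_, ?_, ?_⟩
    · rw [abs_of_nonneg h3, abs_of_nonneg hy]; exact h1
    · rw [abs_of_nonneg (by linarith)]; linarith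
    · rw [abs_of_nonneg (by linarith), abs_of_nonneg hy]; linarith
  · have h1 := Int.le_ceil y
    have h2 := Int.ceil_lt_add_one y
    have h3 : ((⌈y⌉ : ℤ) : ℝ) ≤ 0 := by exact_mod_cast Int.ceil_nonpos.2 hy
    refine ⟨⌈y⌉, ?_, ?_, ?_⟩
    · rw [abs_of_nonpos h3, abs_of_nonpos hy]; linarith
    · rw [abs_of_nonpos (by linarith)]; linarith
    · rw [abs_of_nonpos (by linarith), abs_of_nonpos hy]; linarith

/-- The exponent is p/q, so q-th powers become p-th powers. For q = ∞ it is 0 and every entry equals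
1. -/
lemma seqNorm_rpow_le_one {ι : Type*} {p q : ℝ≥0∞} (hp1 : 1 ≤ p) (hq1 : 1 ≤ q) (hp : p ≠ ∞)
    {f : ι → ℝ} (hf : seqNorm p f ≤ 1) :
    seqNorm q (fun n => |f n| ^ (recip q * p.toReal)) ≤ 1 := by
  by_cases hq : q = ∞
  · subst hq
    rw [seqNorm_top]
    simp [recip_top]
  · have h0 := toReal_pos_of_one_le hq1 hq
    rw [seqNorm_le_iff hp1 hp, ENNReal.one_rpow] at hf
    rw [seqNorm_le_iff hq1 hq, ENNReal.one_rpow]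
    refine le_trans (le_of_eq (tsum_congr fun n => ?_)) hf
    rw [Real.enorm_rpow_of_nonneg (abs_nonneg _) (mul_nonneg (recip_nonneg q) ENNReal.toReal_nonneg),
      ← ENNReal.rpow_mul, recip_eq_inv, mul_right_comm, inv_mul_cancel₀ h0.ne', one_mul,
      Real.enorm_abs]

lemma le_rpow_mul_rpow {z t w θ : ℝ} (hz : 0 ≤ z) (h1 : z ≤ t) (h2 : z ≤ w) (hθ0 : 0 ≤ θ)
    (hθ1 : θ ≤ 1) : z ≤ t ^ (1 - θ) * w ^ θ := by
  rcases hz.eq_or_lt with rfl | hz'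
  · positivity
  · calc z = z ^ (1 - θ) * z ^ θ := by rw [← Real.rpow_add hz', sub_add_cancel, Real.rpow_one]
      _ ≤ t ^ (1 - θ) * w ^ θ :=
        mul_le_mul (Real.rpow_le_rpow hz h1 (by linarith)) (Real.rpow_le_rpow hz h2 hθ0)
          (by positivity) (Real.rpow_nonneg (hz.trans h1) _)

lemma seqNorm_head_le {p : ℝ≥0∞} [Fact (1 ≤ p)] (hp : p ≠ ∞) {f : ℕ+ → ℝ}
    (hf : seqNorm p f ≤ 1) (d : ℕ) : ∑ i : Fin d, |f (i : ℕ).succPNat| ^ p.toReal ≤ 1 := by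
  have h0 : 0 < p.toReal := toReal_pos_of_one_le Fact.out hp
  have h1 := ENNReal.ofReal_le_one.1 ((norm_hd_le d f).trans hf)
  rw [PiLp.norm_eq_sum h0] at h1
  have h2 : 0 ≤ ∑ i : Fin d, |f (i : ℕ).succPNat| ^ p.toReal :=
    Finset.sum_nonneg fun i _ => by positivity
  by_contra hc
  exact absurd h1 (not_le.2 (Real.one_lt_rpow (not_le.1 hc) (by positivity)))

/-- Covering an ellipsoid by truncating each coordinate to a multiple of a step size: the number of
centers is at most the number of integer points in a weighted `ℓ^1` ball. -/
lemma metricEntropy_le_of_truncation {p q : ℝ≥0∞} [Fact (1 ≤ p)] [Fact (1 ≤ q)] (hpq : p < q)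
    {b : ℝ} (hb : 0 < b) {μ : ℕ+ → ℝ} (hpos : ∀ n, 0 < μ n) {M : ℝ} (hM : 0 < M)
    (hμM : ∀ n : ℕ+, μ n ≤ M * (n : ℝ) ^ (-b)) {ε l : ℝ} (hε : 0 < ε) (hl : 0 < l) :
    ∃ d : ℕ, metricEntropy ε (ellipsoidIn p q μ) ≤
      (((l + ∑ i ∈ Finset.range d, Real.log (1 + 2 / (Real.exp
        (l * (ε * (((i : ℝ) + 1) ^ b / M)) ^ (1 / (recip p - recip q))) - 1))) /
          Real.log 2 : ℝ) : EReal) := by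
  have hp : p ≠ ∞ := hpq.ne_top
  have hp1 : 1 ≤ p := Fact.out
  have hq1 : 1 ≤ q := Fact.out
  have hp0 : 0 < p.toReal := toReal_pos_of_one_le hp1 hp
  have hp1' : 1 ≤ p.toReal := by simpa using ENNReal.toReal_mono hp hp1
  have hrlt : recip q < recip p := recip_lt_recip hp1 hpq
  set θ := recip q * p.toReal with hθ
  have hθ0 : 0 ≤ θ := mul_nonneg (recip_nonneg q) hp0.le
  have hPp : recip p * p.toReal = 1 := by rw [recip_eq_inv, inv_mul_cancel₀ hp0.ne']
  have hθ1 : θ < 1 := by rw [← hPp]; exact mul_lt_mul_of_pos_right hrlt hp0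
  have hs : 1 / (1 - θ) * p.toReal = 1 / (recip p - recip q) := by
    have h1 : 1 - θ ≠ 0 := by linarith
    have h2 : recip p - recip q ≠ 0 := by linarith
    field_simp
    linear_combination hPp
  set s := 1 / (recip p - recip q) with hs'
  have hs0 : 0 < s := by rw [hs']; have : 0 < recip p - recip q := by linarith
                         positivity
  -- A pure power below 1/μ_n, so that the final count depends on the semi-axes only through `M` and
  -- `b`.
  let w : ℕ+ → ℝ := fun n => (n : ℝ) ^ b / M
  have hn0 : ∀ n : ℕ+, (0 : ℝ) < n := fun n => by exact_mod_cast n.pos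
  have hw : ∀ n, 0 < w n := fun n => by have := hn0 n; positivity
  have hwμ : ∀ n, w n ≤ (μ n)⁻¹ := fun n => by
    rw [le_inv_comm₀ (hw n) (hpos n), inv_div]
    refine (hμM n).trans (le_of_eq ?_)
    rw [Real.rpow_neg (hn0 n).le]; rfl
  -- The step solves t^(1-θ) = ε w^θ with θ = p/q. A rounding error that is at most t and at most
  -- |f| is then at most t^(1-θ)|f|^θ ≤ ε|f/μ|^θ, and the last sequence has ℓ^q norm at most ε.
  let t : ℕ+ → ℝ := fun n => (ε * w n ^ θ) ^ (1 / (1 - θ))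
  have ht : ∀ n, 0 < t n := fun n => by have := hw n; positivity
  have htθ : ∀ n, t n ^ (1 - θ) = ε * w n ^ θ := fun n => by
    have := hw n
    rw [← Real.rpow_mul (by positivity), one_div_mul_cancel (by linarith), Real.rpow_one]
  have htw : ∀ n, (t n * w n) ^ p.toReal = (ε * w n) ^ s := fun n => by
    have := hw n
    have h1 : t n * w n = (ε * w n) ^ (1 / (1 - θ)) := by
      have h2 : w n = (w n ^ (1 - θ)) ^ (1 / (1 - θ)) := by
        rw [← Real.rpow_mul (by positivity), mul_one_div_cancel (by linarith), Real.rpow_one]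
      calc t n * w n = t n * (w n ^ (1 - θ)) ^ (1 / (1 - θ)) := by rw [← h2]
        _ = _ := ?_
      rw [← Real.mul_rpow (by positivity) (by positivity), mul_assoc, ← Real.rpow_add (hw n),
        add_sub_cancel, Real.rpow_one]
    rw [h1, ← Real.rpow_mul (by positivity), hs]
  let a : ℕ+ → ℝ := fun n => (ε * w n) ^ s
  have ha : ∀ n, 0 < a n := fun n => by have := hw n; positivity
  -- Beyond d a nonzero integer would alone exceed the weighted budget 1, so those coordinates round
  -- to 0.
  obtain ⟨d, hd⟩ : ∃ d : ℕ, ∀ n : ℕ+, ¬ n.natPred < d → 1 < a n := by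
    have h1 : Tendsto (fun x : ℝ => ε * (x ^ b / M)) atTop atTop :=
      ((tendsto_rpow_atTop hb).atTop_div_const hM).const_mul_atTop hε
    obtain ⟨R, hR⟩ := (h1.eventually_gt_atTop 1).exists_forall_of_atTop
    obtain ⟨d, hd⟩ := exists_nat_ge R
    refine ⟨d, fun n hn => Real.one_lt_rpow (hR n (hd.trans ?_)) hs0⟩
    have := PNat.natPred_add_one n
    exact_mod_cast (by omega : d ≤ (n : ℕ))
  obtain ⟨T, hT, hcard⟩ := exists_finset_lattice (fun i : Fin d => ha (i : ℕ).succPNat) hl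
  refine ⟨d, ?_⟩
  let F : (Fin d → ℤ) → lp (fun _ : ℕ+ => ℝ) q :=
    fun k => ⟨emb (fun i => (k i : ℝ) * t (i : ℕ).succPNat), memℓp_emb _⟩
  have hlog : ∑ i : Fin d, Real.log (1 + 2 / (Real.exp (l * a (i : ℕ).succPNat) - 1)) =
      ∑ i ∈ Finset.range d, Real.log (1 + 2 / (Real.exp
        (l * (ε * (((i : ℝ) + 1) ^ b / M)) ^ s) - 1)) := by
    rw [Finset.sum_range]
    refine Finset.sum_congr rfl fun i _ => ?_
    simp [a, w]
  have hE1 : 1 ≤ Real.exp (l + ∑ i : Fin d,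
      Real.log (1 + 2 / (Real.exp (l * a (i : ℕ).succPNat) - 1))) := by
    refine Real.one_le_exp (add_nonneg hl.le (Finset.sum_nonneg fun i _ => Real.log_nonneg ?_))
    have : 0 < Real.exp (l * a (i : ℕ).succPNat) - 1 :=
      sub_pos.2 (Real.one_lt_exp_iff.2 (mul_pos hl (ha _)))
    have : 0 ≤ 2 / (Real.exp (l * a (i : ℕ).succPNat) - 1) := by positivity
    linarith
  have hmain := metricEntropy_le (ε := ε) (A := ellipsoidIn p q μ) (C := F '' (T : Set (Fin d → ℤ)))
    hE1 ?_ (T.finite_toSet.image F) ?_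
  · rw [Real.log_exp, hlog] at hmain
    exact hmain
  · intro x hx
    have hx' := (mem_ellipsoid_iff.1 hx).2
    obtain ⟨f, hf⟩ : ∃ f : ℕ+ → ℝ, (x : ℕ+ → ℝ) = f := ⟨_, rfl⟩
    rw [hf] at hx'
    choose k hk1 hk2 hk3 using fun n : ℕ+ => exists_truncation (f n / t n)
    -- Since |k| ≤ |k|^p for integers and p ≥ 1, the ℓ^p constraint yields a linear one with weights
    -- a_n = (t_n w_n)^p.
    have hka : ∀ n, a n * |(k n : ℝ)| ≤ |f n / μ n| ^ p.toReal := fun n => by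
      have h1 : |(k n : ℝ)| ≤ |(k n : ℝ)| ^ p.toReal := by
        rcases eq_or_ne (k n) 0 with h | h
        · simp [h, hp0.ne']
        · have h2 : (1 : ℝ) ≤ |(k n : ℝ)| := by exact_mod_cast Int.one_le_abs h
          simpa using Real.rpow_le_rpow_of_exponent_le h2 hp1'
      calc a n * |(k n : ℝ)| ≤ (t n * w n) ^ p.toReal * |(k n : ℝ)| ^ p.toReal := by
            rw [htw]; exact mul_le_mul_of_nonneg_left h1 (ha n).le
        _ = (t n * w n * |(k n : ℝ)|) ^ p.toReal :=
            (Real.mul_rpow (mul_pos (ht n) (hw n)).le (abs_nonneg _)).symm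
        _ ≤ |f n / μ n| ^ p.toReal := by
            refine Real.rpow_le_rpow (by have := ht n; have := hw n; positivity) ?_ hp0.le
            calc t n * w n * |(k n : ℝ)| ≤ t n * (μ n)⁻¹ * |f n / t n| := by
                  have := ht n
                  have := hpos n
                  exact mul_le_mul (by gcongr; exact hwμ n) (hk1 n) (abs_nonneg _) (by positivity)
              _ = |f n / μ n| := by
                  rw [abs_div, abs_div, abs_of_pos (ht n), abs_of_pos (hpos n)]
                  field_simp [(ht n).ne']
    have hk0 : ∀ n : ℕ+, ¬ n.natPred < d → k n = 0 := fun n hn => by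
      by_contra hne
      have h2 : (1 : ℝ) ≤ |(k n : ℝ)| := by exact_mod_cast Int.one_le_abs hne
      have h3 := hd n hn
      have h4 : |f n / μ n| ^ p.toReal ≤ 1 := by
        refine Real.rpow_le_one (abs_nonneg _) ?_ hp0.le
        have := (enorm_le_seqNorm hp1 (fun n => f n / μ n) n).trans hx'
        rw [Real.enorm_eq_ofReal_abs] at this
        exact ENNReal.ofReal_le_one.1 this
      nlinarith [hka n]
    refine ⟨F fun i => k (i : ℕ).succPNat, Set.mem_image_of_mem _ (hT _ ?_), ?_⟩
    · exact (Finset.sum_le_sum fun (i : Fin d) _ => hka (i : ℕ).succPNat).trans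
        (seqNorm_head_le hp hx' d)
    · have hbound : ∀ n, |f n - emb (fun i : Fin d =>
          (k (i : ℕ).succPNat : ℝ) * t (i : ℕ).succPNat) n| ≤
          |ε * |f n / μ n| ^ θ| := fun n => by
        have hval : emb (fun i : Fin d => (k (i : ℕ).succPNat : ℝ) * t (i : ℕ).succPNat) n =
            k n * t n := by
          by_cases hn : n.natPred < d
          · simp [emb, hn]
          · simp [emb, hn, hk0 n hn]
        have hz : |f n - k n * t n| = t n * |f n / t n - k n| := by
          rw [← abs_of_pos (ht n), ← abs_mul, abs_of_pos (ht n), mul_sub,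
            mul_div_cancel₀ _ (ht n).ne', mul_comm (t n)]
        rw [hval]
        have h1 : |f n - k n * t n| ≤ t n := by
          rw [hz]; exact mul_le_of_le_one_right (ht n).le (hk2 n)
        have h2 : |f n - k n * t n| ≤ |f n| := by
          rw [hz]
          refine (mul_le_mul_of_nonneg_left (hk3 n) (ht n).le).trans (le_of_eq ?_)
          rw [abs_div, abs_of_pos (ht n), mul_div_cancel₀ _ (ht n).ne']
        refine (le_rpow_mul_rpow (abs_nonneg _) h1 h2 hθ0 hθ1.le).trans ?_
        have hw0 := hw n
        rw [htθ, abs_of_nonneg (show 0 ≤ ε * |f n / μ n| ^ θ by positivity), mul_assoc,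
          ← Real.mul_rpow (hw n).le (abs_nonneg _), abs_div, abs_of_pos (hpos n),
          div_eq_inv_mul]
        have h3 := mul_le_mul_of_nonneg_right (hwμ n) (abs_nonneg (f n))
        have h4 := Real.rpow_le_rpow (by positivity) h3 hθ0
        exact mul_le_mul_of_nonneg_left h4 hε.le
      change edist x _ ≤ _
      rw [lp_edist_eq, hf]
      refine (seqNorm_mono hbound).trans ?_
      rw [seqNorm_const_mul hq1, Real.enorm_eq_ofReal hε.le]
      calc ENNReal.ofReal ε * seqNorm q (fun n => |f n / μ n| ^ θ)
          ≤ ENNReal.ofReal ε * 1 := by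
            gcongr
            exact seqNorm_rpow_le_one hp1 hq1 hp hx'
        _ = _ := by rw [mul_one]; rfl
  · refine le_trans ?_ hcard
    have := Set.ncard_image_le (f := F) T.finite_toSet
    rw [Set.ncard_coe_finset] at this
    exact_mod_cast this

lemma exists_semiaxis_le {b c : ℝ} {μ : ℕ+ → ℝ}
    (hμ : Tendsto (fun i : ℕ => μ i.succPNat * ((i : ℝ) + 1) ^ b) atTop (𝓝 c)) :
    ∃ M : ℝ, 0 < M ∧ ∀ n : ℕ+, μ n ≤ M * (n : ℝ) ^ (-b) := by
  obtain ⟨M, hM⟩ := hμ.bddAbove_range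
  refine ⟨max M 1, by positivity, fun n => ?_⟩
  have hn : (0 : ℝ) < n := by exact_mod_cast n.pos
  have h1 := hM ⟨n.natPred, rfl⟩
  have h2 : ((n.natPred : ℝ) + 1) = n := by exact_mod_cast PNat.natPred_add_one n
  simp only [PNat.succPNat_natPred, h2] at h1
  rw [Real.rpow_neg hn.le, ← div_eq_mul_inv, le_div_iff₀ (by positivity)]
  exact h1.trans (le_max_left _ _)

/-- For `p < q` the entropy is `O(ε ^ (-1 / b*))`. -/
lemma exists_metricEntropy_le {p q : ℝ≥0∞} [Fact (1 ≤ p)] [Fact (1 ≤ q)] (hpq : p < q)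
    {b c : ℝ} (hb : 0 < b) {μ : ℕ+ → ℝ} (hpos : ∀ n, 0 < μ n)
    (hμ : Tendsto (fun i : ℕ => μ i.succPNat * ((i : ℝ) + 1) ^ b) atTop (𝓝 c)) :
    ∃ C : ℝ, 0 < C ∧ ∀ ε : ℝ, 0 < ε → ε ≤ 1 →
      metricEntropy ε (ellipsoidIn p q μ) ≤ ((C * ε ^ (-(1 / bStar p q b)) : ℝ) : EReal) := by
  obtain ⟨M, hM, hμM⟩ := exists_semiaxis_le hμ
  have hrlt : 0 < recip p - recip q := sub_pos.2 (recip_lt_recip Fact.out hpq)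
  set s := 1 / (recip p - recip q) with hs
  have hs0 : 0 < s := by positivity
  have hB : bStar p q b = b + 1 / s := by rw [hs, one_div_one_div, bStar]; ring
  have hB0 : 0 < bStar p q b := by rw [hB]; positivity
  set B := bStar p q b with hBdef
  -- The two values of τ make bsτ equal to 1/2 and 2, the two decay rates required by
  -- `sum_le_of_decay`.
  obtain ⟨C₁, hC₁, h₁⟩ := exists_log_one_add_le (τ := 1 / 2 / (b * s)) (by positivity)
  obtain ⟨C₂, hC₂, h₂⟩ := exists_log_one_add_le (τ := 2 / (b * s)) (by positivity)
  set κ := (M ^ s)⁻¹ with hκ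
  have hκ0 : 0 < κ := by positivity
  set A := max (C₁ * κ ^ (-(1 / 2 / (b * s)))) (C₂ * κ ^ (-(2 / (b * s)))) with hA
  have hA0 : 0 < A := lt_max_of_lt_left (by positivity)
  have hlog2 := Real.log_pos one_lt_two
  refine ⟨(1 + 4 * A) / Real.log 2, by positivity, fun ε hε hε1 => ?_⟩
  set l := ε ^ (-(1 / B)) with hl
  have hl0 : 0 < l := by positivity
  have hl1 : 1 ≤ l := Real.one_le_rpow_of_pos_of_le_one_of_nonpos hε hε1
    (by rw [neg_nonpos]; positivity)
  obtain ⟨d, hd⟩ := metricEntropy_le_of_truncation hpq hb hpos hM hμM hε hl0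
  refine hd.trans (EReal.coe_le_coe_iff.2 ?_)
  -- With l = ε^(-1/B) and Bs = bs + 1, the weights depend on i only through (i + 1)/l, so the
  -- exponent is a Riemann sum at scale l.
  have harg : ∀ i : ℕ, l * (ε * (((i : ℝ) + 1) ^ b / M)) ^ s =
      κ * (((i : ℝ) + 1) / l) ^ (b * s) := fun i => by
    have hi : (0 : ℝ) < (i : ℝ) + 1 := by positivity
    have h3 : l * ε ^ s = l ^ (-(b * s)) := by
      rw [hl, ← Real.rpow_add hε, ← Real.rpow_mul hε.le]
      congr 1
      have : B * s = b * s + 1 := by rw [hB]; field_simp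
      field_simp
      linear_combination this
    rw [Real.mul_rpow hε.le (by positivity), Real.div_rpow (by positivity) hM.le,
      Real.div_rpow hi.le hl0.le, ← mul_assoc, h3, ← Real.rpow_mul hi.le, Real.rpow_neg hl0.le, hκ]
    field_simp
  rw [← hs]
  simp only [harg]
  have key : ∀ (τ C : ℝ), (∀ y : ℝ, 0 < y → Real.log (1 + 2 / (Real.exp y - 1)) ≤ C * y ^ (-τ)) →
      ∀ i : ℕ, Real.log (1 + 2 / (Real.exp (κ * (((i : ℝ) + 1) / l) ^ (b * s)) - 1)) ≤
        C * κ ^ (-τ) * (((i : ℝ) + 1) / l) ^ (-(b * s * τ)) := fun τ C h i => by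
    have hi : (0 : ℝ) < ((i : ℝ) + 1) / l := by positivity
    refine (h _ (by positivity)).trans (le_of_eq ?_)
    rw [Real.mul_rpow hκ0.le (by positivity), ← Real.rpow_mul hi.le, mul_neg, ← mul_assoc]
  have hsum := sum_le_of_decay (C := A) (l := l) hA0.le hl1
    (fun i : ℕ => Real.log (1 + 2 / (Real.exp (κ * (((i : ℝ) + 1) / l) ^ (b * s)) - 1)))
    (fun i => ?_) (fun i => ?_) (fun i => ?_) d
  · rw [div_mul_eq_mul_div]
    gcongr
    linarith
  · refine (key _ _ h₁ i).trans ?_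
    rw [mul_div_cancel₀ _ (by positivity)]
    gcongr
    exact le_max_left _ _
  · refine (key _ _ h₂ i).trans ?_
    rw [mul_div_cancel₀ _ (by positivity)]
    gcongr
    exact le_max_right _ _
  · refine Real.log_nonneg ?_
    have : 0 < Real.exp (κ * (((i : ℝ) + 1) / l) ^ (b * s)) - 1 :=
      sub_pos.2 (Real.one_lt_exp_iff.2 (by positivity))
    have : 0 ≤ 2 / (Real.exp (κ * (((i : ℝ) + 1) / l) ^ (b * s)) - 1) := by positivity
    linarith

/-! ### Stirling asymptotics for factorials, Γ and the semi-axes -/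

section Stirling

lemma tendsto_log_factorial_div :
    Tendsto (fun n : ℕ => Real.log n.factorial / n - Real.log n) atTop (𝓝 (-1)) := by
  have h1 : Tendsto (fun n : ℕ => Real.log (Stirling.stirlingSeq n) / n) atTop (𝓝 0) := by
    have := (Real.continuousAt_log (Real.sqrt_pos.2 Real.pi_pos).ne').tendsto.comp
      Stirling.tendsto_stirlingSeq_sqrt_pi
    exact this.div_atTop tendsto_natCast_atTop_atTop
  have h2 : Tendsto (fun n : ℕ => Real.log (2 * n) / (2 * n)) atTop (𝓝 0) := by
    have h := Real.isLittleO_log_id_atTop.tendsto_div_nhds_zero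
    exact h.comp (tendsto_natCast_atTop_atTop.const_mul_atTop (zero_lt_two (α := ℝ)))
  have h3 := (h1.add h2).add_const (-1)
  rw [add_zero, zero_add] at h3
  refine h3.congr' ?_
  filter_upwards [eventually_gt_atTop 0] with n hn
  have hn' : (0 : ℝ) < n := by exact_mod_cast hn
  rw [Stirling.log_stirlingSeq_formula, Real.log_div hn'.ne' (Real.exp_pos 1).ne', Real.log_exp]
  field_simp
  ring

/-- Γ increases on [2, ∞), so Γ(y + 1) lies between ⌊y⌋! and (⌊y⌋ + 1)! ≤ 2y ⌊y⌋!. The loss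
log(2y)/y vanishes, which reduces the claim to factorials. -/
lemma tendsto_log_Gamma_div :
    Tendsto (fun y : ℝ => Real.log (Real.Gamma (y + 1)) / y - Real.log y) atTop (𝓝 (-1)) := by
  have hfl := tendsto_nat_floor_atTop (α := ℝ)
  have hratio : Tendsto (fun y : ℝ => (⌊y⌋₊ : ℝ) / y) atTop (𝓝 1) := tendsto_nat_floor_div_atTop
  have h1 : Tendsto (fun y : ℝ => (⌊y⌋₊ : ℝ) / y *
      (Real.log (⌊y⌋₊.factorial) / ⌊y⌋₊ - Real.log ⌊y⌋₊)) atTop (𝓝 (-1)) := by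
    simpa using hratio.mul (tendsto_log_factorial_div.comp hfl)
  have hlogratio : Tendsto (fun y : ℝ => Real.log ((⌊y⌋₊ : ℝ) / y)) atTop (𝓝 0) := by
    simpa [Function.comp_def] using (Real.continuousAt_log one_ne_zero).tendsto.comp hratio
  have hlog0 : Tendsto (fun y : ℝ => Real.log y / y) atTop (𝓝 0) :=
    Real.isLittleO_log_id_atTop.tendsto_div_nhds_zero
  have h2 : Tendsto (fun y : ℝ => ((⌊y⌋₊ : ℝ) / y - 1) * Real.log y) atTop (𝓝 0) := by
    refine squeeze_zero_norm' ?_ hlog0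
    filter_upwards [eventually_ge_atTop 1] with y hy
    have hy0 : 0 < y := by linarith
    have ha := Nat.floor_le hy0.le
    have hb := Nat.lt_floor_add_one y
    rw [norm_mul, Real.norm_of_nonneg (Real.log_nonneg hy), div_sub_one hy0.ne', norm_div,
      Real.norm_of_nonneg hy0.le, div_mul_eq_mul_div]
    gcongr
    refine mul_le_of_le_one_left (Real.log_nonneg hy) ?_
    rw [Real.norm_of_nonpos (by linarith)]
    linarith
  have h3 : Tendsto (fun y : ℝ => (Real.log (Real.Gamma (y + 1)) - Real.log (⌊y⌋₊.factorial)) / y)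
      atTop (𝓝 0) := by
    have hbd : Tendsto (fun y : ℝ => Real.log 2 / y + Real.log y / y) atTop (𝓝 0) := by
      simpa using (tendsto_const_nhds.div_atTop tendsto_id).add hlog0
    refine squeeze_zero' ?_ ?_ hbd
    all_goals
      filter_upwards [eventually_ge_atTop 1] with y hy
      have hy0 : 0 < y := by linarith
      have ha := Nat.floor_le hy0.le
      have hb := Nat.lt_floor_add_one y
      have hn1 : (1 : ℝ) ≤ ⌊y⌋₊ := by exact_mod_cast Nat.le_floor (by simpa using hy)
      have hf0 : (0 : ℝ) < ⌊y⌋₊.factorial := by exact_mod_cast Nat.factorial_pos _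
      have hmono := Real.Gamma_strictMonoOn_Ici.monotoneOn
    · have h : ((⌊y⌋₊.factorial : ℕ) : ℝ) ≤ Real.Gamma (y + 1) := by
        rw [← Real.Gamma_nat_eq_factorial]
        exact hmono (Set.mem_Ici.2 (by linarith)) (Set.mem_Ici.2 (by linarith)) (by linarith)
      exact div_nonneg (sub_nonneg.2 (Real.log_le_log hf0 h)) hy0.le
    · have h : Real.Gamma (y + 1) ≤ (2 * y) * ((⌊y⌋₊.factorial : ℕ) : ℝ) := by
        calc Real.Gamma (y + 1) ≤ Real.Gamma ((⌊y⌋₊ + 1 : ℕ) + 1) := by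
              refine hmono (Set.mem_Ici.2 (by linarith)) (Set.mem_Ici.2 ?_) ?_ <;>
                push_cast <;> linarith
          _ = (⌊y⌋₊ + 1) * ((⌊y⌋₊.factorial : ℕ) : ℝ) := by
              rw [Real.Gamma_nat_eq_factorial, Nat.factorial_succ]; push_cast; ring
          _ ≤ _ := by gcongr; linarith
      have h' := Real.log_le_log (Real.Gamma_pos_of_pos (by linarith)) h
      rw [Real.log_mul (by positivity) hf0.ne', Real.log_mul two_ne_zero hy0.ne'] at h'
      rw [← add_div]
      gcongr
      linarith
  have h := ((h1.add (hratio.mul hlogratio)).add h2).add h3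
  simp only [mul_zero, add_zero] at h
  refine h.congr' ?_
  filter_upwards [eventually_ge_atTop 1] with y hy
  have hy0 : 0 < y := by linarith
  have hn0 : (0 : ℝ) < ⌊y⌋₊ := by
    exact_mod_cast Nat.pos_of_ne_zero (by simpa using (Nat.floor_pos.2 hy).ne')
  rw [Real.log_div hn0.ne' hy0.ne']
  field_simp
  ring

/-- The case x = 0, needed for an infinite exponent, uses the convention 0 log 0 = 0. -/
lemma tendsto_log_Gamma_nat_mul {x : ℝ} (hx : 0 ≤ x) :
    Tendsto (fun d : ℕ => Real.log (Real.Gamma (d * x + 1)) / d - x * Real.log d) atTop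
      (𝓝 (x * Real.log x - x)) := by
  rcases hx.eq_or_lt with rfl | hx
  · simp
  · have h1 : Tendsto (fun d : ℕ => (d : ℝ) * x) atTop atTop :=
      tendsto_natCast_atTop_atTop.atTop_mul_const hx
    have h2 := ((tendsto_log_Gamma_div.comp h1).mul_const x).add_const (x * Real.log x)
    rw [show -1 * x + x * Real.log x = x * Real.log x - x by ring] at h2
    refine h2.congr' ?_
    filter_upwards [eventually_gt_atTop 0] with d hd
    have hd' : (0 : ℝ) < d := by exact_mod_cast hd
    simp only [Function.comp]
    rw [Real.log_mul hd'.ne' hx.ne']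
    field_simp
    ring

/-- The Cesàro means of log(μ_i i^b) tend to log c; removing the powers leaves b log(d!)/d, which
Stirling evaluates. -/
lemma tendsto_sum_log_semiaxis {b c : ℝ} {μ : ℕ+ → ℝ} (hc : 0 < c) (hpos : ∀ n, 0 < μ n)
    (hμ : Tendsto (fun i : ℕ => μ i.succPNat * ((i : ℝ) + 1) ^ b) atTop (𝓝 c)) :
    Tendsto (fun d : ℕ => (∑ i ∈ Finset.range d, Real.log (μ i.succPNat)) / d + b * Real.log d)
      atTop (𝓝 (Real.log c + b)) := by
  have h1 := ((Real.continuousAt_log hc.ne').tendsto.comp hμ).cesaro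
  have h2 := h1.sub (tendsto_log_factorial_div.const_mul b)
  rw [show Real.log c - b * -1 = Real.log c + b by ring] at h2
  refine h2.congr fun d => ?_
  have h3 : ∀ i : ℕ, Real.log (μ i.succPNat * ((i : ℝ) + 1) ^ b) =
      Real.log (μ i.succPNat) + b * Real.log ((i : ℝ) + 1) := fun i => by
    rw [Real.log_mul (hpos _).ne' (by positivity), Real.log_rpow (by positivity)]
  have h4 : Real.log (d.factorial) = ∑ i ∈ Finset.range d, Real.log ((i : ℝ) + 1) := by
    rw [← Finset.prod_range_add_one_eq_factorial, Nat.cast_prod, Real.log_prod]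
    · simp
    · intro i _; positivity
  simp only [Function.comp, h3, Finset.sum_add_distrib, ← Finset.mul_sum, h4]
  ring

end Stirling

/-! ### Volumes of ℓ^p balls and the volume lower bound -/

section Volume

/-- The Lebesgue volume of the unit ball of `ℓ^p` in dimension `d`. -/
noncomputable def lpBallVolume (p : ℝ≥0∞) (d : ℕ) : ℝ :=
  (2 * Real.Gamma (recip p + 1)) ^ d / Real.Gamma (d * recip p + 1)

lemma lpBallVolume_pos (p : ℝ≥0∞) (d : ℕ) : 0 < lpBallVolume p d := by
  have h := recip_nonneg p
  have h1 := Real.Gamma_pos_of_pos (show 0 < recip p + 1 by linarith)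
  have h2 := Real.Gamma_pos_of_pos (show 0 < d * recip p + 1 by positivity)
  unfold lpBallVolume
  positivity

lemma volume_lpBall (p : ℝ≥0∞) [Fact (1 ≤ p)] {d : ℕ} (hd0 : 0 < d) :
    volume {y : Fin d → ℝ | ‖WithLp.toLp p y‖ ≤ 1} = ENNReal.ofReal (lpBallVolume p d) := by
  have : Nonempty (Fin d) := ⟨⟨0, hd0⟩⟩
  by_cases hp : p = ∞
  · subst hp
    have h : {y : Fin d → ℝ | ‖WithLp.toLp ∞ y‖ ≤ 1} = Metric.closedBall 0 1 := by
      ext y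
      simp [PiLp.norm_toLp]
    rw [h, Real.volume_pi_closedBall _ zero_le_one]
    simp [lpBallVolume, recip_top]
  · have hp0 : 0 < p.toReal := toReal_pos_of_one_le Fact.out hp
    have hp1 : 1 ≤ p.toReal := by simpa using ENNReal.toReal_mono hp (Fact.out : 1 ≤ p)
    have := volume_sum_rpow_le (Fin d) hp1 1
    simp only [ENNReal.ofReal_one, one_pow, one_mul, Fintype.card_fin] at this
    simp only [PiLp.norm_eq_sum hp0, Real.norm_eq_abs]
    rw [this, lpBallVolume, recip_eq_inv, one_div, div_eq_mul_inv (d : ℝ)]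

lemma volume_scaled_lpBall (p : ℝ≥0∞) [Fact (1 ≤ p)] {d : ℕ} (hd0 : 0 < d) {a : Fin d → ℝ}
    (ha : ∀ i, 0 < a i) (z : Fin d → ℝ) :
    volume {y : Fin d → ℝ | ‖WithLp.toLp p (fun i => (y i - z i) / a i)‖ ≤ 1} =
      ENNReal.ofReal ((∏ i, a i) * lpBallVolume p d) := by
  have hprod : 0 < ∏ i, a i := Finset.prod_pos fun i _ => ha i
  have hdet : LinearMap.det (Matrix.toLin' (Matrix.diagonal fun i => (a i)⁻¹)) =
      (∏ i, a i)⁻¹ := by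
    rw [LinearMap.det_toLin', Matrix.det_diagonal, Finset.prod_inv_distrib]
  have h1 : {y : Fin d → ℝ | ‖WithLp.toLp p (fun i => (y i - z i) / a i)‖ ≤ 1} =
      (fun y => y + -z) ⁻¹' ((Matrix.toLin' (Matrix.diagonal fun i => (a i)⁻¹)) ⁻¹'
        {y : Fin d → ℝ | ‖WithLp.toLp p y‖ ≤ 1}) := by
    ext y
    simp only [Set.mem_ofPred_eq, Set.mem_preimage, Matrix.toLin'_apply]
    have : (Matrix.diagonal fun i => (a i)⁻¹).mulVec (y + -z) = fun i => (y i - z i) / a i := by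
      funext i
      rw [Matrix.mulVec_diagonal, Pi.add_apply, Pi.neg_apply, ← sub_eq_add_neg, div_eq_inv_mul]
    rw [this]
  rw [h1, measure_preimage_add_right, Measure.addHaar_preimage_linearMap volume
    (by rw [hdet]; exact inv_ne_zero hprod.ne'), hdet, inv_inv, abs_of_pos hprod,
    volume_lpBall p hd0, ← ENNReal.ofReal_mul hprod.le]

/-- Volume comparison: a finite cover of the ellipsoid has at least
`(∏ μ_i) vol(B_p) / (ε ^ d vol(B_q))` elements. -/
lemma le_log_ncard_of_isCover {p q : ℝ≥0∞} [Fact (1 ≤ p)] [Fact (1 ≤ q)] {μ : ℕ+ → ℝ}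
    (hpos : ∀ n, 0 < μ n) {ε : ℝ} (hε : 0 < ε) {d : ℕ} (hd0 : 0 < d)
    {C : Set (lp (fun _ : ℕ+ => ℝ) q)} (hfin : C.Finite)
    (hC : Metric.IsCover ε.toNNReal (ellipsoidIn p q μ) C) :
    ∑ i ∈ Finset.range d, Real.log (μ i.succPNat) + Real.log (lpBallVolume p d) -
      Real.log (lpBallVolume q d) - d * Real.log ε ≤ Real.log C.ncard := by
  -- Passing to the first d coordinates does not increase ℓ^q distances, so the heads of the centers
  -- cover the d-dimensional section.
  have hsub : {y : Fin d → ℝ | ‖WithLp.toLp p (fun i => (y i - (0 : Fin d → ℝ) i) /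
      μ (i : ℕ).succPNat)‖ ≤ 1} ⊆ ⋃ x ∈ hfin.toFinset, {y : Fin d → ℝ |
        ‖WithLp.toLp q (fun i => (y i - hd d x i) / ε)‖ ≤ 1} := by
    intro y hy
    simp only [Pi.zero_apply, sub_zero, Set.mem_ofPred_eq] at hy
    obtain ⟨x, hx, hxy⟩ := isCover_iff.1 hC ⟨emb y, memℓp_emb y⟩ (emb_mem_ellipsoid hy)
    refine Set.mem_biUnion (hfin.mem_toFinset.2 hx) ?_
    have h1 := (norm_hd_le d _).trans ((lp_edist_eq (q := q) _ _).symm.le.trans hxy)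
    have h2 : hd d (emb y - (x : ℕ+ → ℝ)) = fun i => y i - hd d x i := by
      funext i
      conv_rhs => rw [← hd_emb y]
      rfl
    rw [show (ε.toNNReal : ℝ≥0∞) = ENNReal.ofReal ε from rfl] at h1
    have h3 := (ENNReal.ofReal_le_ofReal_iff hε.le).1 h1
    have h4 : WithLp.toLp q (fun i => (y i - hd d x i) / ε) =
        ε⁻¹ • WithLp.toLp q (fun i => y i - hd d x i) := by
      rw [← WithLp.toLp_smul]
      congr 1
      funext i
      simp [div_eq_inv_mul]
    rw [Set.mem_ofPred_eq, h4, norm_smul, norm_inv, Real.norm_of_nonneg hε.le,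
      inv_mul_le_one₀ hε, ← h2]
    exact h3
  have hvol := (measure_mono hsub).trans (measure_biUnion_finset_le (μ := volume) _ _)
  rw [volume_scaled_lpBall p hd0 (fun i => hpos _)] at hvol
  simp only [volume_scaled_lpBall q hd0 (fun _ => hε)] at hvol
  rw [Finset.sum_const, nsmul_eq_mul, ← Set.ncard_eq_toFinset_card C hfin, Finset.prod_const,
    Finset.card_univ, Fintype.card_fin, ← ENNReal.ofReal_natCast,
    ← ENNReal.ofReal_mul (by positivity)] at hvol
  have hVp := lpBallVolume_pos p d
  have hVq := lpBallVolume_pos q d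
  have hprod : 0 < ∏ i : Fin d, μ (i : ℕ).succPNat := Finset.prod_pos fun i _ => hpos _
  have h1 := (ENNReal.ofReal_le_ofReal_iff (by positivity)).1 hvol
  have hN : 0 < (C.ncard : ℝ) := by
    by_contra hc
    have : (C.ncard : ℝ) = 0 := le_antisymm (not_lt.1 hc) (by positivity)
    rw [this, zero_mul] at h1
    exact absurd h1 (not_le.2 (by positivity))
  have h2 := Real.log_le_log (by positivity) h1
  rw [Real.log_mul hprod.ne' hVp.ne', Real.log_mul hN.ne' (by positivity),
    Real.log_mul (by positivity) hVq.ne', Real.log_pow, Real.log_prod (fun i _ => (hpos _).ne'),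
    ← Finset.sum_range (fun i => Real.log (μ i.succPNat))] at h2
  linarith

end Volume

/-! ### Asymptotic lower bound -/

lemma tendsto_log_lpBallVolume (p : ℝ≥0∞) :
    Tendsto (fun d : ℕ => Real.log (lpBallVolume p d) / d + recip p * Real.log d) atTop
      (𝓝 (Real.log 2 + Real.log (Real.Gamma (recip p + 1)) -
        (recip p * Real.log (recip p) - recip p))) := by
  have hP := recip_nonneg p
  have hG := Real.Gamma_pos_of_pos (show 0 < recip p + 1 by linarith)
  have h := (tendsto_log_Gamma_nat_mul hP).const_sub
    (Real.log 2 + Real.log (Real.Gamma (recip p + 1)))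
  refine h.congr' ?_
  filter_upwards [eventually_gt_atTop 0] with d hd
  have hd' : (0 : ℝ) < d := by exact_mod_cast hd
  have hG' := Real.Gamma_pos_of_pos (show 0 < d * recip p + 1 by positivity)
  rw [lpBallVolume, Real.log_div (by positivity) hG'.ne', Real.log_pow,
    Real.log_mul two_ne_zero hG.ne']
  field_simp
  ring

lemma selfRoot_pos {p : ℝ≥0∞} (h1 : 1 ≤ p) : 0 < selfRoot p := by
  unfold selfRoot
  split_ifs with h
  · exact one_pos
  · exact Real.rpow_pos_of_pos (toReal_pos_of_one_le h1 h) _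

lemma log_selfRoot {p : ℝ≥0∞} (h1 : 1 ≤ p) :
    Real.log (selfRoot p) = -(recip p * Real.log (recip p)) := by
  unfold selfRoot
  split_ifs with h
  · simp [h, recip_top]
  · rw [Real.log_rpow (toReal_pos_of_one_le h1 h), recip_eq_inv, Real.log_inv]
    ring

lemma GammaConst_pos {p q : ℝ≥0∞} (hp : 1 ≤ p) (hq : 1 ≤ q) : 0 < GammaConst p q := by
  have h1 := selfRoot_pos hp
  have h2 := selfRoot_pos hq
  have h3 := Real.Gamma_pos_of_pos (show 0 < recip p + 1 by linarith [recip_nonneg p])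
  have h4 := Real.Gamma_pos_of_pos (show 0 < recip q + 1 by linarith [recip_nonneg q])
  unfold GammaConst
  positivity

/-- Identifies Γ_{p,q} with the Stirling constants of vol(B_p)/vol(B_q), in which the terms log 2
cancel. -/
lemma log_GammaConst {p q : ℝ≥0∞} (hp : 1 ≤ p) (hq : 1 ≤ q) :
    Real.log (GammaConst p q) =
      (Real.log (Real.Gamma (recip p + 1)) - (recip p * Real.log (recip p) - recip p)) -
      (Real.log (Real.Gamma (recip q + 1)) - (recip q * Real.log (recip q) - recip q)) := by
  have h1 := selfRoot_pos hp
  have h2 := selfRoot_pos hq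
  have h3 := Real.Gamma_pos_of_pos (show 0 < recip p + 1 by linarith [recip_nonneg p])
  have h4 := Real.Gamma_pos_of_pos (show 0 < recip q + 1 by linarith [recip_nonneg q])
  rw [GammaConst, Real.log_div (by positivity) (by positivity), Real.log_mul h3.ne' h1.ne',
    Real.log_mul (by positivity) (by positivity), Real.log_mul h4.ne' h2.ne', Real.log_exp,
    log_selfRoot hp, log_selfRoot hq]
  ring

lemma tendsto_div_rpow_atTop {K B : ℝ} (hK : 0 < K) (hB : 0 < B) :
    Tendsto (fun ε : ℝ => (K / ε) ^ (1 / B)) (𝓝[>] 0) atTop := by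
  have h1 : Tendsto (fun ε : ℝ => K / ε) (𝓝[>] 0) atTop := by
    simpa only [div_eq_mul_inv] using tendsto_inv_nhdsGT_zero.const_mul_atTop hK
  exact (tendsto_rpow_atTop (by positivity)).comp h1

lemma div_rpow_eq {K B ε : ℝ} (hK : 0 < K) (hε : 0 < ε) :
    (K / ε) ^ (1 / B) = K ^ (1 / B) * ε ^ (-(1 / B)) := by
  rw [Real.div_rpow hK.le hε.le, Real.rpow_neg hε.le, div_eq_mul_inv]

lemma log_eq_of_div_rpow {K B ε : ℝ} (hK : 0 < K) (hB : B ≠ 0) (hε : 0 < ε) :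
    Real.log ε = Real.log K - B * Real.log ((K / ε) ^ (1 / B)) := by
  rw [Real.log_rpow (by positivity), Real.log_div hK.ne' hε.ne']
  field_simp
  ring

lemma ellipsoidIn_nonempty (p q : ℝ≥0∞) [Fact (1 ≤ p)] [Fact (1 ≤ q)] (μ : ℕ+ → ℝ) :
    (ellipsoidIn p q μ).Nonempty := by
  have h : emb (0 : Fin 0 → ℝ) ∈ ellipsoid p μ := by
    refine emb_mem_ellipsoid ?_
    rw [Subsingleton.elim (fun i : Fin 0 => (0 : Fin 0 → ℝ) i / μ (i : ℕ).succPNat) 0,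
      WithLp.toLp_zero, norm_zero]
    exact zero_le_one
  exact ⟨⟨emb (0 : Fin 0 → ℝ), memℓp_emb _⟩, h⟩

/-- The asymptotic lower bound for the entropy. -/
lemma eventually_le_metricEntropy {p q : ℝ≥0∞} [Fact (1 ≤ p)] [Fact (1 ≤ q)] {b c : ℝ}
    (hb : 0 < b) (hc : 0 < c) {μ : ℕ+ → ℝ} (hpos : ∀ n, 0 < μ n)
    (hμ : Tendsto (fun i : ℕ => μ i.succPNat * ((i : ℝ) + 1) ^ b) atTop (𝓝 c))
    (hB : 0 < bStar p q b) {η : ℝ} (hη : 0 < η) :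
    ∀ᶠ ε : ℝ in 𝓝[>] 0, ((b / Real.log 2 * (GammaConst p q * c / ε) ^ (1 / bStar p q b) -
      η * ε ^ (-(1 / bStar p q b)) : ℝ) : EReal) ≤ metricEntropy ε (ellipsoidIn p q μ) := by
  have hp1 : 1 ≤ p := Fact.out
  have hq1 : 1 ≤ q := Fact.out
  set B := bStar p q b with hBdef
  have hΓ := GammaConst_pos hp1 hq1
  set K := GammaConst p q * c with hK
  have hK0 : 0 < K := by positivity
  have hlog2 := Real.log_pos one_lt_two
  -- The error budget, measured against L = (K/ε)^(1/B), is η ln 2 / K^(1/B). Half of it absorbs the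
  -- o(1) in Stirling, half the rounding of L to an integer; the bound b/2 keeps b - η' positive.
  set η' := min (b / 2) (η * Real.log 2 / K ^ (1 / B) / 2) with hη'
  have hη'0 : 0 < η' := by positivity
  have hG : Tendsto (fun d : ℕ => (∑ i ∈ Finset.range d, Real.log (μ i.succPNat) +
      Real.log (lpBallVolume p d) - Real.log (lpBallVolume q d)) / d + B * Real.log d) atTop
      (𝓝 (Real.log K + b)) := by
    have h := ((tendsto_sum_log_semiaxis hc hpos hμ).add (tendsto_log_lpBallVolume p)).sub
      (tendsto_log_lpBallVolume q)
    have hlim : Real.log K + b = Real.log c + b + (Real.log 2 + Real.log (Real.Gamma (recip p + 1)) -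
        (recip p * Real.log (recip p) - recip p)) - (Real.log 2 +
        Real.log (Real.Gamma (recip q + 1)) - (recip q * Real.log (recip q) - recip q)) := by
      rw [hK, Real.log_mul hΓ.ne' hc.ne', log_GammaConst hp1 hq1]
      ring
    rw [hlim]
    refine h.congr fun d => ?_
    rw [hBdef, bStar]
    ring
  have hL := tendsto_div_rpow_atTop hK0 hB
  have hd := (tendsto_nat_floor_atTop (α := ℝ)).comp hL
  have hev := hd.eventually (hG.eventually (lt_mem_nhds (show Real.log K + b - η' <
    Real.log K + b by linarith)))
  filter_upwards [hev, hL.eventually_ge_atTop 1, hL.eventually_ge_atTop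
    (b / (η * Real.log 2 / K ^ (1 / B) / 2)), self_mem_nhdsWithin] with ε h1 h2 h3 h4
  have hε : 0 < ε := h4
  simp only [Function.comp] at h1
  have hlogε := log_eq_of_div_rpow hK0 hB.ne' hε
  have hLε := div_rpow_eq (B := B) hK0 hε
  set L := (K / ε) ^ (1 / B) with hLdef
  have hd0 : 0 < ⌊L⌋₊ := Nat.floor_pos.2 h2
  set d := ⌊L⌋₊ with hddef
  have hd0' : (0 : ℝ) < d := by exact_mod_cast hd0
  have hdL : (d : ℝ) ≤ L := Nat.floor_le (by linarith)
  have hLd : L < d + 1 := Nat.lt_floor_add_one L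
  have hrew : b / Real.log 2 * L - η * ε ^ (-(1 / B)) =
      (b * L - η * Real.log 2 / K ^ (1 / B) * L) / Real.log 2 := by
    have : K ^ (1 / B) ≠ 0 := by positivity
    rw [hLε]
    field_simp
  rw [hrew]
  refine le_metricEntropy (ellipsoidIn_nonempty p q μ) fun C hfin hC => ?_
  refine le_trans ?_ (le_log_ncard_of_isCover hpos hε hd0 hfin hC)
  have hlogd : Real.log d ≤ Real.log L := Real.log_le_log hd0' hdL
  set S := ∑ i ∈ Finset.range d, Real.log (μ i.succPNat) +
      Real.log (lpBallVolume p d) - Real.log (lpBallVolume q d) with hS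
  -- Here log ε = log K - B log L, so with d ≤ L the terms in log K and log d drop out and only b
  -- remains per dimension.
  have h5 : d * (b - η') ≤ S - d * Real.log ε := by
    have h6 : S = d * (S / d) := by field_simp
    rw [h6, hlogε, ← mul_sub]
    refine mul_le_mul_of_nonneg_left ?_ hd0'.le
    have := mul_le_mul_of_nonneg_left hlogd hB.le
    linarith
  refine le_trans ?_ h5
  have h7 : η' ≤ b / 2 := min_le_left _ _
  have h8 : η' ≤ η * Real.log 2 / K ^ (1 / B) / 2 := min_le_right _ _
  have h9 : b ≤ η * Real.log 2 / K ^ (1 / B) / 2 * L := by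
    rw [div_le_iff₀ (by positivity)] at h3
    linarith
  have h10 : (L - 1) * (b - η') ≤ d * (b - η') :=
    mul_le_mul_of_nonneg_right (by linarith) (by linarith)
  nlinarith [mul_le_mul_of_nonneg_right h8 (show 0 ≤ L by linarith)]

/-! ### Greedy covering by averaging -/

section Greedy

variable {α : Type*} [MeasurableSpace α] {ν : Measure α} [SFinite ν]

/-- Averaging: if every point of `U` is covered by a `v / ν Y` proportion of the sets centered in
`Y`, then some set covers that proportion of `U`. -/
lemma exists_measure_inter_ge {E : Set (α × α)} (hE : MeasurableSet E) {U Y : Set α}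
    (hU : MeasurableSet U) (hY : MeasurableSet Y) (hY0 : ν Y ≠ 0) (hYt : ν Y ≠ ∞)
    (hUt : ν U ≠ ∞) {v : ℝ≥0∞} (hv : ∀ u ∈ U, v ≤ ν (Y ∩ {y | (y, u) ∈ E})) :
    ∃ y ∈ Y, v / ν Y * ν U ≤ ν (U ∩ {u | (y, u) ∈ E}) := by
  have hEl : ∀ y, MeasurableSet {u | (y, u) ∈ E} := fun y => measurable_prodMk_left hE
  have hEr : ∀ u, MeasurableSet {y | (y, u) ∈ E} := fun u => measurable_prodMk_right hE
  -- Tonelli: both sides measure the pairs of `E` in Y × U. Some center then does at least as well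
  -- as the average.
  have hswap : ∫⁻ y in Y, ν (U ∩ {u | (y, u) ∈ E}) ∂ν = ∫⁻ u in U, ν (Y ∩ {y | (y, u) ∈ E}) ∂ν := by
    have h1 : ∀ y, ν (U ∩ {u | (y, u) ∈ E}) = ∫⁻ u in U, E.indicator 1 (y, u) ∂ν := fun y => by
      rw [Set.inter_comm, ← Measure.restrict_apply (hEl y), ← lintegral_indicator_one (hEl y)]
      rfl
    have h2 : ∀ u, ν (Y ∩ {y | (y, u) ∈ E}) = ∫⁻ y in Y, E.indicator 1 (y, u) ∂ν := fun u => by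
      rw [Set.inter_comm, ← Measure.restrict_apply (hEr u), ← lintegral_indicator_one (hEr u)]
      rfl
    simp only [h1, h2]
    exact lintegral_lintegral_swap ((measurable_one.indicator hE).aemeasurable)
  have hle : v * ν U ≤ ∫⁻ y in Y, ν (U ∩ {u | (y, u) ∈ E}) ∂ν := by
    rw [hswap, ← setLIntegral_const]
    exact setLIntegral_mono' hU hv
  have hfin : ∫⁻ y in Y, ν (U ∩ {u | (y, u) ∈ E}) ∂ν ≠ ∞ := by
    refine ((setLIntegral_mono' hY fun y _ => measure_mono Set.inter_subset_left).trans_lt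
      (b := ∫⁻ _ in Y, ν U ∂ν) ?_).ne
    rw [setLIntegral_const]
    exact ENNReal.mul_lt_top hUt.lt_top hYt.lt_top
  obtain ⟨y, hy, h⟩ := exists_setLAverage_le hY0 hY.nullMeasurableSet hfin
  refine ⟨y, hy, le_trans ?_ h⟩
  rw [setLAverage_eq, div_eq_mul_inv, mul_right_comm, ← div_eq_mul_inv]
  gcongr

/-- The hypothesis `hv` passes to the uncovered part of `U`, so each new center can be chosen to
remove a proportion v / ν Y of what is left. -/
lemma exists_finset_measure_diff_le {E : Set (α × α)} (hE : MeasurableSet E) {U Y : Set α}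
    (hU : MeasurableSet U) (hY : MeasurableSet Y) (hY0 : ν Y ≠ 0) (hYt : ν Y ≠ ∞)
    (hUt : ν U ≠ ∞) {v : ℝ≥0∞} (hv : ∀ u ∈ U, v ≤ ν (Y ∩ {y | (y, u) ∈ E})) (n : ℕ) :
    ∃ S : Finset α, S.card ≤ n ∧
      ν (U \ ⋃ y ∈ S, {u | (y, u) ∈ E}) ≤ (1 - v / ν Y) ^ n * ν U := by
  classical
  induction n with
  | zero => exact ⟨∅, by simp, by simp⟩
  | succ n ih =>
    obtain ⟨S, hS, hle⟩ := ih
    have hmeas : MeasurableSet (U \ ⋃ y ∈ S, {u | (y, u) ∈ E}) :=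
      hU.diff (S.measurableSet_biUnion fun y _ => measurable_prodMk_left hE)
    set U' := U \ ⋃ y ∈ S, {u | (y, u) ∈ E} with hU'
    have hU't : ν U' ≠ ∞ := ne_top_of_le_ne_top hUt (measure_mono Set.sdiff_subset)
    obtain ⟨y, -, hy⟩ := exists_measure_inter_ge hE hmeas hY hY0 hYt hU't
      fun u hu => hv u hu.1
    refine ⟨insert y S, (Finset.card_insert_le _ _).trans (by omega), ?_⟩
    have h1 : U \ ⋃ z ∈ insert y S, {u | (z, u) ∈ E} = U' \ {u | (y, u) ∈ E} := by
      rw [Finset.set_biUnion_insert, Set.union_comm, ← Set.sdiff_sdiff]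
    rw [h1, pow_succ', mul_assoc]
    have hEy : MeasurableSet {u | (y, u) ∈ E} := measurable_prodMk_left hE
    have h2 := measure_inter_add_sdiff (μ := ν) U' hEy
    have h3 : ν (U' \ {u | (y, u) ∈ E}) ≤ (1 - v / ν Y) * ν U' := by
      rw [ENNReal.sub_mul (fun _ _ => hU't), one_mul]
      refine ENNReal.le_sub_of_add_le_left (ne_top_of_le_ne_top hU't
        (hy.trans (measure_mono Set.inter_subset_left))) ?_
      calc _ ≤ ν (U' ∩ {u | (y, u) ∈ E}) + ν (U' \ {u | (y, u) ∈ E}) := by gcongr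
        _ = ν U' := h2
    exact h3.trans (by gcongr)

end Greedy

/-! ### Economical covering of a stretched ℓ^q ball -/

section Rogers

variable {q : ℝ≥0∞} [Fact (1 ≤ q)] {d : ℕ}

lemma norm_toLp_mono {f g : Fin d → ℝ} (h : ∀ i, |f i| ≤ |g i|) :
    ‖WithLp.toLp q f‖ ≤ ‖WithLp.toLp q g‖ := by
  have := seqNorm_mono (q := q) h
  rw [seqNorm_eq_norm_toLp, seqNorm_eq_norm_toLp] at this
  exact (ENNReal.ofReal_le_ofReal_iff (norm_nonneg _)).1 this

lemma norm_toLp_mul (a : ℝ) (f : Fin d → ℝ) :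
    ‖WithLp.toLp q (fun i => a * f i)‖ = |a| * ‖WithLp.toLp q f‖ := by
  rw [← Real.norm_eq_abs, ← norm_smul, ← WithLp.toLp_smul]
  rfl

lemma norm_toLp_add_le (f g : Fin d → ℝ) :
    ‖WithLp.toLp q (fun i => f i + g i)‖ ≤ ‖WithLp.toLp q f‖ + ‖WithLp.toLp q g‖ :=
  norm_add_le (WithLp.toLp q f) (WithLp.toLp q g)

lemma norm_toLp_div_le_iff {a : ℝ} (ha : 0 < a) (f : Fin d → ℝ) :
    ‖WithLp.toLp q (fun i => f i / a)‖ ≤ 1 ↔ ‖WithLp.toLp q f‖ ≤ a := by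
  have : (fun i => f i / a) = fun i => a⁻¹ * f i := by funext i; rw [div_eq_inv_mul]
  rw [this, norm_toLp_mul, abs_of_pos (inv_pos.2 ha), inv_mul_le_one₀ ha]

lemma continuous_norm_toLp {X : Type*} [TopologicalSpace X] {f : X → Fin d → ℝ}
    (hf : Continuous f) : Continuous fun x => ‖WithLp.toLp q (f x)‖ :=
  ((PiLp.continuous_toLp q _).comp hf).norm

/-- A diagonal image of the unit ball of `ℓ^q` that contains the unit ball can be covered by unit
balls with a number of balls that exceeds the volume bound by a subexponential factor only. -/
lemma exists_finset_cover_scaled_ball (hd : 0 < d) {w : Fin d → ℝ} (hw : ∀ i, 1 ≤ w i) {δ : ℝ}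
    (hδ0 : 0 < δ) (hδ1 : δ < 1) :
    ∃ S : Finset (Fin d → ℝ), (∀ x : Fin d → ℝ, ‖WithLp.toLp q (fun i => x i / w i)‖ ≤ 1 →
        ∃ y ∈ S, ‖WithLp.toLp q (fun i => x i - y i)‖ ≤ 1) ∧
      (S.card : ℝ) ≤ (2 / (1 - δ)) ^ d * (∏ i, w i) *
        Real.log (((1 + δ) / δ) ^ d * ∏ i, w i) + 1 := by
  have hw0 : ∀ i, 0 < w i := fun i => zero_lt_one.trans_le (hw i)
  have hρ : 0 < 1 - δ := by linarith
  set W := ∏ i, w i with hW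
  have hW1 : 1 ≤ W := by
    simpa using Finset.prod_le_prod (s := Finset.univ) (f := fun _ : Fin d => (1 : ℝ))
      (fun _ _ => zero_le_one) fun i _ => hw i
  have hV := lpBallVolume_pos q d
  set V := lpBallVolume q d with hVdef
  -- `U` is the body enlarged by 1 + δ, and it is covered up to small measure by balls of radius 1 -
  -- δ. A point of the body missed at radius 1 would leave a whole δ-ball of `U` uncovered, so a
  -- remainder smaller than that ball suffices.
  let U : Set (Fin d → ℝ) :=
    {y | ‖WithLp.toLp q (fun i => (y i - (0 : Fin d → ℝ) i) / ((1 + δ) * w i))‖ ≤ 1}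
  let Y : Set (Fin d → ℝ) :=
    {y | ‖WithLp.toLp q (fun i => (y i - (0 : Fin d → ℝ) i) / (2 * w i))‖ ≤ 1}
  let E : Set ((Fin d → ℝ) × (Fin d → ℝ)) :=
    {z | ‖WithLp.toLp q (fun i => (z.1 i - z.2 i) / (1 - δ))‖ ≤ 1}
  have memU : ∀ y : Fin d → ℝ, y ∈ U ↔ ‖WithLp.toLp q (fun i => y i / w i)‖ ≤ 1 + δ := fun y => by
    rw [← norm_toLp_div_le_iff (by linarith)]
    simp only [U, Set.mem_ofPred_eq, Pi.zero_apply, sub_zero, div_div, mul_comm (1 + δ)]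
  have memY : ∀ y : Fin d → ℝ, y ∈ Y ↔ ‖WithLp.toLp q (fun i => y i / w i)‖ ≤ 2 := fun y => by
    rw [← norm_toLp_div_le_iff (by linarith)]
    simp only [Y, Set.mem_ofPred_eq, Pi.zero_apply, sub_zero, div_div, mul_comm (2 : ℝ)]
  have memE : ∀ y u : Fin d → ℝ, (y, u) ∈ E ↔ ‖WithLp.toLp q (fun i => y i - u i)‖ ≤ 1 - δ :=
    fun y u => by rw [← norm_toLp_div_le_iff hρ]; rfl
  have tri : ∀ {x y : Fin d → ℝ} {r s : ℝ}, ‖WithLp.toLp q (fun i => x i / w i)‖ ≤ r →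
      ‖WithLp.toLp q (fun i => y i - x i)‖ ≤ s →
      ‖WithLp.toLp q (fun i => y i / w i)‖ ≤ r + s := fun {x y r s} h1 h2 => by
    have h3 : (fun i => y i / w i) = fun i => x i / w i + (y i - x i) / w i := by
      funext i; ring
    rw [h3]
    refine (norm_toLp_add_le _ _).trans (add_le_add h1 (le_trans (norm_toLp_mono fun i => ?_) h2))
    rw [abs_div, abs_of_pos (hw0 i)]
    exact div_le_self (abs_nonneg _) (hw i)
  have hvolU : volume U = ENNReal.ofReal ((1 + δ) ^ d * W * V) := by
    rw [volume_scaled_lpBall q hd (fun i => mul_pos (by linarith) (hw0 i)) 0,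
      Finset.prod_mul_distrib, Finset.prod_const, Finset.card_univ, Fintype.card_fin]
  have hvolY : volume Y = ENNReal.ofReal (2 ^ d * W * V) := by
    rw [volume_scaled_lpBall q hd (fun i => mul_pos two_pos (hw0 i)) 0,
      Finset.prod_mul_distrib, Finset.prod_const, Finset.card_univ, Fintype.card_fin]
  have hball : ∀ {r : ℝ} (_ : 0 < r) (u : Fin d → ℝ),
      volume {y : Fin d → ℝ | ‖WithLp.toLp q (fun i => (y i - u i) / r)‖ ≤ 1} =
        ENNReal.ofReal (r ^ d * V) := fun {r} hr u => by
    rw [volume_scaled_lpBall q hd (fun _ => hr), Finset.prod_const, Finset.card_univ,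
      Fintype.card_fin]
  have hEm : MeasurableSet E := by
    refine (isClosed_le (continuous_norm_toLp ?_) continuous_const).measurableSet
    fun_prop
  have hUm : MeasurableSet U := by
    refine (isClosed_le (continuous_norm_toLp ?_) continuous_const).measurableSet
    fun_prop
  have hYm : MeasurableSet Y := by
    refine (isClosed_le (continuous_norm_toLp ?_) continuous_const).measurableSet
    fun_prop
  -- Since all w_i ≥ 1, the ball of radius 1 - δ about a point of `U` stays in the body scaled by (1
  -- + δ) + (1 - δ) = 2. This is the source of the factor 2 per dimension.
  have hv : ∀ u ∈ U, ENNReal.ofReal ((1 - δ) ^ d * V) ≤ volume (Y ∩ {y | (y, u) ∈ E}) := by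
    intro u hu
    have : {y | (y, u) ∈ E} ⊆ Y := fun y hy => by
      have := tri ((memU u).1 hu) ((memE y u).1 hy)
      rw [memY]
      linarith
    rw [Set.inter_eq_right.2 this, ← hball hρ u]
    rfl
  set π := ((1 - δ) / 2) ^ d / W with hπ
  have hπ0 : 0 < π := by positivity
  have hπ1 : π ≤ 1 := by
    rw [hπ, div_le_one (by positivity)]
    exact (pow_le_one₀ (by positivity) (by linarith)).trans hW1
  set Q := ((1 + δ) / δ) ^ d * W with hQ
  have hQ1 : 1 ≤ Q := by
    have : 1 ≤ ((1 + δ) / δ) ^ d := one_le_pow₀ (by rw [le_div_iff₀ hδ0]; linarith)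
    nlinarith
  -- `π` is the proportion removed per step and `Q` is vol(U) divided by the volume of a δ-ball;
  -- this n forces (1 - π)^n < 1/Q.
  set n := ⌊Real.log Q / π⌋₊ + 1 with hn
  obtain ⟨S, hScard, hS⟩ := exists_finset_measure_diff_le hEm hUm hYm
    (by rw [hvolY]; exact (ENNReal.ofReal_pos.2 (by positivity)).ne')
    (by rw [hvolY]; exact ENNReal.ofReal_ne_top) (by rw [hvolU]; exact ENNReal.ofReal_ne_top) hv n
  have hlt : volume (U \ ⋃ y ∈ S, {u | (y, u) ∈ E}) < ENNReal.ofReal (δ ^ d * V) := by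
    refine hS.trans_lt ?_
    have h1 : 1 - ENNReal.ofReal ((1 - δ) ^ d * V) / volume Y = ENNReal.ofReal (1 - π) := by
      rw [hvolY, ← ENNReal.ofReal_div_of_pos (by positivity), ENNReal.ofReal_sub _ hπ0.le,
        ENNReal.ofReal_one]
      congr 2
      rw [hπ, div_pow]
      field_simp
    rw [h1, hvolU, ← ENNReal.ofReal_pow (by linarith), ← ENNReal.ofReal_mul (by
      exact pow_nonneg (by linarith) _)]
    refine (ENNReal.ofReal_lt_ofReal_iff (by positivity)).2 ?_
    have h2 : (1 - π) ^ n ≤ Real.exp (-(π * n)) := by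
      have := Real.add_one_le_exp (-π)
      calc (1 - π) ^ n ≤ Real.exp (-π) ^ n := pow_le_pow_left₀ (by linarith) (by linarith) n
        _ = _ := by rw [← Real.exp_nat_mul]; congr 1; ring
    have h3 : Real.log Q < π * n := by
      have := Nat.lt_floor_add_one (Real.log Q / π)
      rw [div_lt_iff₀ hπ0] at this
      rw [hn]
      push_cast
      linarith
    have h4 : (1 - π) ^ n < Q⁻¹ := by
      refine h2.trans_lt ?_
      calc Real.exp (-(π * n)) < Real.exp (-Real.log Q) := Real.exp_lt_exp.2 (by linarith)
        _ = Q⁻¹ := by rw [Real.exp_neg, Real.exp_log (by linarith)]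
    calc (1 - π) ^ n * ((1 + δ) ^ d * W * V) < Q⁻¹ * ((1 + δ) ^ d * W * V) := by
          exact mul_lt_mul_of_pos_right h4 (by positivity)
      _ = δ ^ d * V := by
          rw [hQ, div_pow]
          field_simp
  refine ⟨S, fun x hx => ?_, ?_⟩
  · by_contra! hno
    have hsub : {y : Fin d → ℝ | ‖WithLp.toLp q (fun i => (y i - x i) / δ)‖ ≤ 1} ⊆
        U \ ⋃ y ∈ S, {u | (y, u) ∈ E} := by
      intro u hu
      have hu' := (norm_toLp_div_le_iff hδ0 (fun i => u i - x i)).1 hu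
      refine ⟨(memU u).2 (tri hx hu'), fun hc => ?_⟩
      simp only [Set.mem_iUnion] at hc
      obtain ⟨y, hy, hyu⟩ := hc
      have hyu' := (memE y u).1 hyu
      have h1 : (fun i => x i - y i) = fun i => (-1) * ((u i - x i) + (y i - u i)) := by
        funext i; ring
      have h2 := hno y hy
      rw [h1, norm_toLp_mul, abs_neg, abs_one, one_mul] at h2
      have h3 := norm_toLp_add_le (q := q) (fun i => u i - x i) (fun i => y i - u i)
      linarith
    have := measure_mono (μ := volume) hsub
    rw [hball hδ0 x] at this
    exact absurd hlt (not_lt.2 this)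
  · have h1 : (S.card : ℝ) ≤ n := by exact_mod_cast hScard
    have h2 : ((⌊Real.log Q / π⌋₊ : ℕ) : ℝ) ≤ Real.log Q / π :=
      Nat.floor_le (div_nonneg (Real.log_nonneg hQ1) hπ0.le)
    have h3 : Real.log Q / π = (2 / (1 - δ)) ^ d * W * Real.log Q := by
      rw [hπ, div_pow, div_pow]
      field_simp
    rw [hn] at h1
    push_cast at h1
    linarith

end Rogers

/-! ### Upper bound for q ≤ p: from head covers to entropy -/

lemma emb_add {d : ℕ} (y z : Fin d → ℝ) : emb (fun i => y i + z i) = emb y + emb z := by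
  funext n
  by_cases hn : n.natPred < d <;> simp [emb, hn]

/-- From a cover of the head of a sequence to a cover in `ℓ^q`; the norm of the head is discretized
to `k + 1` levels. -/
lemma metricEntropy_le_of_head_cover {q : ℝ≥0∞} [Fact (1 ≤ q)] {d : ℕ} {w : Fin d → ℝ}
    {S : Finset (Fin d → ℝ)}
    (hS : ∀ x : Fin d → ℝ, ‖WithLp.toLp q (fun i => x i / w i)‖ ≤ 1 →
      ∃ y ∈ S, ‖WithLp.toLp q (fun i => x i - y i)‖ ≤ 1)
    {A : Set (lp (fun _ : ℕ+ => ℝ) q)} {τ : ℝ} (hτ : 0 < τ)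
    (hA : ∀ x ∈ A, seqNorm q (emb (fun i : Fin d => (x : ℕ+ → ℝ) (i : ℕ).succPNat / w i) +
      tl d (x : ℕ+ → ℝ)) ≤ ENNReal.ofReal τ)
    {k : ℕ} (hk : 0 < k) {N : ℝ} (hN1 : 1 ≤ N) (hN : (k + 1) * (S.card : ℝ) ≤ N) :
    metricEntropy (τ * (1 + 1 / k)) A ≤ ((Real.log N / Real.log 2 : ℝ) : EReal) := by
  have hq1 : 1 ≤ q := Fact.out
  have hk0 : (0 : ℝ) < k := by exact_mod_cast hk
  let F : ℕ × (Fin d → ℝ) → lp (fun _ : ℕ+ => ℝ) q :=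
    fun z => ⟨emb (fun i => τ * (((z.1 : ℝ) + 1) / k * z.2 i)), memℓp_emb _⟩
  refine metricEntropy_le (C := F '' (Finset.range (k + 1) ×ˢ S : Finset _)) hN1 ?_
    ((Finset.finite_toSet _).image F) ?_
  · intro x hx
    have hAx := hA x hx
    obtain ⟨g, hg⟩ : ∃ g : ℕ+ → ℝ, (x : ℕ+ → ℝ) = g := ⟨_, rfl⟩
    rw [hg] at hAx
    set f : ℕ+ → ℝ := fun n => τ⁻¹ * g n with hf
    have hgf : ∀ n, g n = τ * f n := fun n => by rw [hf]; field_simp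
    set h : Fin d → ℝ := fun i => f (i : ℕ).succPNat / w i with hh
    have hsc : seqNorm q (emb h + tl d f) ≤ 1 := by
      have h1 : emb h + tl d f = fun n => τ⁻¹ *
          (emb (fun i : Fin d => g (i : ℕ).succPNat / w i) + tl d g) n := by
        funext n
        by_cases hn : n.natPred < d
        · simp [emb, tl, hn, hh, hf, mul_div_assoc]
        · simp [emb, tl, hn, hf]
      rw [h1, seqNorm_const_mul hq1, Real.enorm_eq_ofReal (inv_pos.2 hτ).le]
      calc _ ≤ ENNReal.ofReal τ⁻¹ * ENNReal.ofReal τ := by gcongr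
        _ = 1 := by rw [← ENNReal.ofReal_mul (inv_pos.2 hτ).le, inv_mul_cancel₀ hτ.ne',
                      ENNReal.ofReal_one]
    set a := ‖WithLp.toLp q h‖ with ha
    have ha0 : 0 ≤ a := norm_nonneg _
    have ha1 : a ≤ 1 := by
      refine ENNReal.ofReal_le_one.1 (le_trans (le_of_eq ?_) ((norm_hd_le d _).trans hsc))
      have : hd d (emb h + tl d f) = h := by
        funext i
        simp [hd, emb, tl]
      rw [this]
    -- The head norm a is rounded up to the level a' = (j + 1)/k, and the cover is scaled by a'.
    set j := ⌊a * k⌋₊ with hj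
    have hj1 : (j : ℝ) ≤ a * k := Nat.floor_le (by positivity)
    have hj2 : a * k < j + 1 := Nat.lt_floor_add_one _
    have hjk : j < k + 1 := by
      have : (j : ℝ) ≤ k := hj1.trans (by nlinarith)
      exact Nat.lt_succ_of_le (by exact_mod_cast this)
    set a' := ((j : ℝ) + 1) / k with ha'
    have ha'0 : 0 < a' := by positivity
    have haa' : a ≤ a' := by rw [ha', le_div_iff₀ hk0]; exact hj2.le
    have ha'a : a' - a ≤ 1 / k := by
      rw [ha', div_sub' hk0.ne']
      gcongr
      linarith
    obtain ⟨y, hyS, hy⟩ := hS (fun i : Fin d => a'⁻¹ * f (i : ℕ).succPNat) (by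
      have h1 : (fun i : Fin d => a'⁻¹ * f (i : ℕ).succPNat / w i) = fun i => a'⁻¹ * h i := by
        funext i; rw [hh, mul_div_assoc]
      rw [h1, norm_toLp_mul, abs_of_pos (inv_pos.2 ha'0), inv_mul_le_one₀ ha'0]
      exact haa')
    set e : Fin d → ℝ := fun i => f (i : ℕ).succPNat - a' * y i with he
    have hea : ‖WithLp.toLp q e‖ ≤ a' := by
      have h1 : e = fun i : Fin d => a' * (a'⁻¹ * f (i : ℕ).succPNat - y i) := by
        funext i; rw [he]; field_simp
      rw [h1, norm_toLp_mul, abs_of_pos ha'0]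
      exact mul_le_of_le_one_right ha'0.le hy
    have hr1 : a / a' ≤ 1 := (div_le_one ha'0).2 haa'
    -- Shrunk by a/a', the head error is no longer than the rescaled head itself and can replace it
    -- beside the tail without exceeding norm 1. What remains has norm at most a' - a ≤ 1/k.
    have he' : ‖WithLp.toLp q (fun i => a / a' * e i)‖ ≤ ‖WithLp.toLp q h‖ := by
      rw [norm_toLp_mul, abs_of_nonneg (by positivity), ← ha]
      calc a / a' * ‖WithLp.toLp q e‖ ≤ a / a' * a' := by gcongr
        _ = a := div_mul_cancel₀ _ ha'0.ne'
    have hrest : ‖WithLp.toLp q (fun i => (1 - a / a') * e i)‖ ≤ 1 / k := by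
      rw [norm_toLp_mul, abs_of_nonneg (by linarith)]
      calc (1 - a / a') * ‖WithLp.toLp q e‖ ≤ (1 - a / a') * a' :=
            mul_le_mul_of_nonneg_left hea (by linarith)
        _ = a' - a := by field_simp
        _ ≤ 1 / k := ha'a
    have htot : seqNorm q (emb e + tl d f) ≤ ENNReal.ofReal (1 + 1 / k) := by
      have h1 : emb e + tl d f = (emb (fun i => a / a' * e i) + tl d f) +
          emb (fun i => (1 - a / a') * e i) := by
        have h2 : emb e = emb (fun i => a / a' * e i) + emb (fun i => (1 - a / a') * e i) := by
          rw [← emb_add]; congr 1; funext i; ring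
        rw [h2]; abel
      rw [h1, ENNReal.ofReal_add zero_le_one (by positivity), ENNReal.ofReal_one]
      refine (seqNorm_add_le hq1 _ _).trans (add_le_add ?_ ?_)
      · exact (seqNorm_emb_add_le _ _ he' f).trans hsc
      · rw [seqNorm_emb]
        exact ENNReal.ofReal_le_ofReal hrest
    refine ⟨F (j, y), Set.mem_image_of_mem _
      (Finset.mem_coe.2 (Finset.mk_mem_product (Finset.mem_range.2 hjk) hyS)), ?_⟩
    change edist x _ ≤ _
    rw [lp_edist_eq, hg]
    have hdiff : g - emb (fun i => τ * (a' * y i)) = fun n => τ * (emb e + tl d f) n := by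
      funext n
      rw [Pi.sub_apply, hgf]
      by_cases hn : n.natPred < d
      · simp [emb, tl, hn, he, mul_sub]
      · simp [emb, tl, hn]
    change seqNorm q (g - emb (fun i => τ * (a' * y i))) ≤ ENNReal.ofReal (τ * (1 + 1 / k))
    rw [hdiff, seqNorm_const_mul hq1, Real.enorm_eq_ofReal hτ.le, ENNReal.ofReal_mul hτ.le]
    gcongr
  · refine le_trans ?_ hN
    have := Set.ncard_image_le (f := F) (Finset.finite_toSet (Finset.range (k + 1) ×ˢ S))
    rw [Set.ncard_coe_finset, Finset.card_product, Finset.card_range] at this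
    exact_mod_cast this

/-- Hölder's inequality for the ellipsoid with its first `d` coordinates rescaled. -/
lemma seqNorm_rescaled_le {p q r : ℝ≥0∞} (hp : 1 ≤ p) (hq : 1 ≤ q) (hr : 1 ≤ r)
    (h : p⁻¹ + r⁻¹ = q⁻¹) {μ : ℕ+ → ℝ} (hpos : ∀ n, 0 < μ n) {d : ℕ} (m : ℝ) {x : ℕ+ → ℝ}
    (hx : x ∈ ellipsoid p μ) :
    seqNorm q (emb (fun i : Fin d => x (i : ℕ).succPNat / (μ (i : ℕ).succPNat / m)) + tl d x) ≤
      seqNorm r (emb (fun _ : Fin d => m) + tl d μ) := by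
  have h1 : emb (fun i : Fin d => x (i : ℕ).succPNat / (μ (i : ℕ).succPNat / m)) + tl d x =
      fun n => x n / μ n * (emb (fun _ : Fin d => m) + tl d μ) n := by
    funext n
    have := (hpos n).ne'
    by_cases hn : n.natPred < d
    · simp only [Pi.add_apply, emb, tl, hn, dite_true, if_true, PNat.succPNat_natPred]
      rw [div_div_eq_mul_div]
      ring
    · simp only [Pi.add_apply, emb, tl, hn, dite_false, if_false, zero_add]
      field_simp
  rw [h1]
  refine (seqNorm_mul_le hp hq hr h _ _).trans ?_
  exact mul_le_of_le_one_left zero_le (mem_ellipsoid_iff.1 hx).2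

/-- Comparison with the integral of x^(-s) from d to infinity. -/
lemma sum_rpow_neg_le {s : ℝ} (hs : 1 < s) {d : ℕ} (hd : 0 < d) (N : ℕ) :
    ∑ i ∈ Finset.range N, ((d : ℝ) + (i + 1 : ℕ)) ^ (-s) ≤ (d : ℝ) ^ (1 - s) / (s - 1) := by
  have hd' : (0 : ℝ) < d := by exact_mod_cast hd
  have hanti : AntitoneOn (fun x : ℝ => x ^ (-s)) (Set.Icc (d : ℝ) (d + N)) :=
    fun x hx y _ hxy => Real.rpow_le_rpow_of_nonpos (hd'.trans_le hx.1) hxy (by linarith)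
  refine (hanti.sum_le_integral).trans ?_
  rw [integral_rpow (Or.inr ⟨by linarith, ?_⟩)]
  · have h1 : (0 : ℝ) ≤ ((d : ℝ) + N) ^ (-s + 1) := by positivity
    rw [show -s + 1 = 1 - s by ring] at *
    rw [← neg_div_neg_eq, neg_sub, neg_sub]
    have : 0 < s - 1 := by linarith
    gcongr
    linarith
  · rw [Set.uIcc_of_le (by linarith [(Nat.cast_nonneg N : (0 : ℝ) ≤ N)])]
    exact fun h => absurd h.1 (not_le.2 hd')

lemma seqNorm_tl {q : ℝ≥0∞} (hq : 1 ≤ q) (d : ℕ) (x : ℕ+ → ℝ) :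
    seqNorm q (tl d x) = seqNorm q (fun i : ℕ => x (d + i).succPNat) := by
  rw [← seqNorm_comp_injective hq (e := fun i : ℕ => (d + i).succPNat)]
  · congr 1
    funext i
    simp [tl]
  · intro i j hij
    have := Nat.succPNat_injective hij
    omega
  · intro n hn
    by_cases h : n.natPred < d
    · simp [tl, h]
    · exact absurd ⟨n.natPred - d, by
        simp only
        rw [Nat.add_sub_cancel' (not_lt.1 h), PNat.succPNat_natPred]⟩ hn

lemma seqNorm_const {r : ℝ≥0∞} (hr : r ≠ ∞) (hr1 : 1 ≤ r) (d : ℕ) {m : ℝ} (hm : 0 ≤ m) :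
    seqNorm r (fun _ : Fin d => m) ^ r.toReal = ENNReal.ofReal (d * m ^ r.toReal) := by
  rw [seqNorm_rpow hr1 hr, tsum_fintype, Finset.sum_const, Finset.card_univ, Fintype.card_fin,
    nsmul_eq_mul, Real.enorm_eq_ofReal hm, ENNReal.ofReal_rpow_of_nonneg hm ENNReal.toReal_nonneg,
    ENNReal.ofReal_mul (by positivity), ENNReal.ofReal_natCast]

lemma seqNorm_emb_eq {q : ℝ≥0∞} (hq : 1 ≤ q) {d : ℕ} (y : Fin d → ℝ) :
    seqNorm q (emb y) = seqNorm q y := by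
  have : Fact (1 ≤ q) := ⟨hq⟩
  rw [seqNorm_emb, seqNorm_eq_norm_toLp]

/-- The norm of the semi-axes, capped on the first `d` coordinates, in the finite-exponent case. -/
lemma seqNorm_capped_le {r : ℝ≥0∞} (hr1 : 1 ≤ r) (hr : r ≠ ∞) {μ : ℕ+ → ℝ}
    (hpos : ∀ n, 0 < μ n) {d : ℕ} (hd : 0 < d) {b A m : ℝ} (hA : 0 < A) (hm : 0 ≤ m)
    (hbr : 1 < b * r.toReal) (hmA : m ≤ A * (d : ℝ) ^ (-b))
    (hμA : ∀ i : ℕ, μ (d + i).succPNat ≤ A * ((d : ℝ) + (i + 1 : ℕ)) ^ (-b)) :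
    seqNorm r (emb (fun _ : Fin d => m) + tl d μ) ≤
      ENNReal.ofReal (A * (b / (b - r.toReal⁻¹)) ^ (r.toReal⁻¹) *
        (d : ℝ) ^ (-(b - r.toReal⁻¹))) := by
  have hR := toReal_pos_of_one_le hr1 hr
  set R := r.toReal with hRdef
  have hd' : (0 : ℝ) < d := by exact_mod_cast hd
  have hgap : 0 < b - R⁻¹ := by
    rw [sub_pos, inv_eq_one_div, div_lt_iff₀ hR]; exact hbr
  have hb : 0 < b := by have := inv_pos.2 hR; linarith
  rw [← ENNReal.rpow_le_rpow_iff hR, seqNorm_emb_add_tl_rpow hr1 hr, seqNorm_emb_eq hr1,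
    seqNorm_const hr hr1 d hm, seqNorm_tl hr1, seqNorm_rpow hr1 hr]
  have htail : ∑' i : ℕ, ‖μ (d + i).succPNat‖ₑ ^ R ≤
      ENNReal.ofReal (A ^ R * ((d : ℝ) ^ (1 - b * R) / (b * R - 1))) := by
    refine ENNReal.tsum_le_of_sum_range_le fun N => ?_
    calc ∑ i ∈ Finset.range N, ‖μ (d + i).succPNat‖ₑ ^ R
        ≤ ∑ i ∈ Finset.range N,
            ENNReal.ofReal (A ^ R * ((d : ℝ) + (i + 1 : ℕ)) ^ (-(b * R))) := by
          refine Finset.sum_le_sum fun i _ => ?_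
          rw [Real.enorm_eq_ofReal (hpos _).le, ENNReal.ofReal_rpow_of_nonneg (hpos _).le hR.le]
          refine ENNReal.ofReal_le_ofReal
            ((Real.rpow_le_rpow (hpos _).le (hμA i) hR.le).trans (le_of_eq ?_))
          rw [Real.mul_rpow hA.le (by positivity), ← Real.rpow_mul (by positivity), neg_mul]
      _ = ENNReal.ofReal (A ^ R *
            ∑ i ∈ Finset.range N, ((d : ℝ) + (i + 1 : ℕ)) ^ (-(b * R))) := by
          rw [Finset.mul_sum, ENNReal.ofReal_sum_of_nonneg fun i _ => by positivity]
      _ ≤ _ := by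
          refine ENNReal.ofReal_le_ofReal ?_
          gcongr
          exact sum_rpow_neg_le hbr hd N
  have hhead : (d : ℝ) * m ^ R ≤ A ^ R * (d : ℝ) ^ (1 - b * R) := by
    calc (d : ℝ) * m ^ R ≤ d * (A * (d : ℝ) ^ (-b)) ^ R := by gcongr
      _ = A ^ R * (d : ℝ) ^ (1 - b * R) := by
          rw [Real.mul_rpow hA.le (by positivity), ← Real.rpow_mul hd'.le, sub_eq_add_neg,
            Real.rpow_add hd', Real.rpow_one, neg_mul]
          ring
  have hbr' : 0 < b * R - 1 := by linarith
  rw [ENNReal.ofReal_rpow_of_nonneg (by positivity) hR.le]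
  calc ENNReal.ofReal (d * m ^ R) + ∑' i : ℕ, ‖μ (d + i).succPNat‖ₑ ^ R
      ≤ ENNReal.ofReal (A ^ R * (d : ℝ) ^ (1 - b * R)) +
          ENNReal.ofReal (A ^ R * ((d : ℝ) ^ (1 - b * R) / (b * R - 1))) :=
        add_le_add (ENNReal.ofReal_le_ofReal hhead) htail
    -- With R = r, head and tail contribute 1 + 1/(bR - 1) = b/(b - 1/R); its R-th root is the
    -- source of γ_{p,q,b}.
    _ = _ := by
        rw [← ENNReal.ofReal_add (by positivity) (by positivity)]
        congr 1
        rw [Real.mul_rpow (by positivity) (by positivity), Real.mul_rpow hA.le (by positivity),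
          ← Real.rpow_mul (by positivity), ← Real.rpow_mul hd'.le, inv_mul_cancel₀ hR.ne',
          Real.rpow_one, show -(b - R⁻¹) * R = 1 - b * R by field_simp; ring]
        field_simp
        ring

/-- The case r = ∞, that is 1/p = 1/q: by monotonicity the cap μ_{d+1} is the supremum of the capped
sequence. -/
lemma seqNorm_capped_top_le {μ : ℕ+ → ℝ} (hpos : ∀ n, 0 < μ n) (hanti : Antitone μ) (d : ℕ) :
    seqNorm ∞ (emb (fun _ : Fin d => μ d.succPNat) + tl d μ) ≤ ENNReal.ofReal (μ d.succPNat) := by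
  rw [seqNorm_top]
  refine iSup_le fun n => ?_
  by_cases hn : n.natPred < d
  · simp [emb, tl, hn, Real.enorm_eq_ofReal (hpos _).le]
  · simp only [Pi.add_apply, emb, tl, hn, dite_false, if_false, zero_add]
    rw [Real.enorm_eq_ofReal (hpos _).le]
    refine ENNReal.ofReal_le_ofReal (hanti ?_)
    rw [← PNat.coe_le_coe, Nat.succPNat_coe, ← PNat.natPred_add_one]
    omega

lemma metricEntropy_anti {X : Type*} [PseudoEMetricSpace X] {ε ε' : ℝ} (h : ε' ≤ ε) (A : Set X) :
    metricEntropy ε A ≤ metricEntropy ε' A := by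
  unfold metricEntropy
  refine EReal.div_le_div_right_of_nonneg (by exact_mod_cast (Real.log_pos one_lt_two).le)
    (ENNReal.log_le_log (ENat.toENNReal_le.2
      (Metric.externalCoveringNumber_anti (Real.toNNReal_le_toNNReal h))))

lemma gammaConst_pos {p q : ℝ≥0∞} {b : ℝ} (hb : 0 < b) (hB : 0 < bStar p q b) :
    0 < gammaConst p q b := Real.rpow_pos_of_pos (div_pos hb hB) _

/-- The Hölder conjugate-type exponent `r` with `1 / r = 1 / q - 1 / p`. -/
lemma exists_holder_exponent {p q : ℝ≥0∞} (hq : 1 ≤ q) (hqp : q ≤ p) :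
    ∃ r : ℝ≥0∞, 1 ≤ r ∧ p⁻¹ + r⁻¹ = q⁻¹ ∧ recip r = recip q - recip p := by
  have hle : p⁻¹ ≤ q⁻¹ := ENNReal.inv_le_inv.2 hqp
  have hq' : q⁻¹ ≠ ∞ := ENNReal.inv_ne_top.2 (zero_lt_one.trans_le hq).ne'
  refine ⟨(q⁻¹ - p⁻¹)⁻¹, ?_, ?_, ?_⟩
  · rw [ENNReal.one_le_inv]
    exact tsub_le_self.trans (ENNReal.inv_le_one.2 hq)
  · rw [inv_inv, add_tsub_cancel_of_le hle]
  · rw [recip, inv_inv, ENNReal.toReal_sub_of_le hle hq']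
    rfl

/-- Past a large d all semi-axes are at most A n^(-b), and the cap is at most A d^(-b). The tail
converges because B = b - 1/r > 0 means br > 1 when r is finite. -/
lemma eventually_capped_le {p q r : ℝ≥0∞} (hr1 : 1 ≤ r) (hr : recip r = recip q - recip p)
    {b c : ℝ} (hc : 0 < c) {μ : ℕ+ → ℝ} (hpos : ∀ n, 0 < μ n) (hanti : Antitone μ)
    (hμ : Tendsto (fun i : ℕ => μ i.succPNat * ((i : ℝ) + 1) ^ b) atTop (𝓝 c))
    (hb : 0 < b) (hB : 0 < bStar p q b) {A : ℝ} (hA : c < A) :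
    ∀ᶠ d : ℕ in atTop, seqNorm r (emb (fun _ : Fin d => μ d.succPNat) + tl d μ) ≤
      ENNReal.ofReal (A * gammaConst p q b * (d : ℝ) ^ (-bStar p q b)) := by
  have hA0 : 0 < A := hc.trans hA
  have hBr : bStar p q b = b - recip r := by rw [hr, bStar]; ring
  have hγ : gammaConst p q b = (b / (b - recip r)) ^ recip r := by
    rw [gammaConst, ← hBr, hr]
  filter_upwards [eventually_forall_ge_atTop.2 (hμ.eventually (gt_mem_nhds hA)), eventually_gt_atTop 0]
    with d hd hd0
  have hd' : (0 : ℝ) < d := by exact_mod_cast hd0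
  have hμA : ∀ i : ℕ, μ (d + i).succPNat ≤ A * ((d : ℝ) + (i + 1 : ℕ)) ^ (-b) := fun i => by
    have h1 := (hd (d + i) (by omega)).le
    have h2 : ((d + i : ℕ) : ℝ) + 1 = (d : ℝ) + (i + 1 : ℕ) := by push_cast; ring
    rw [h2] at h1
    rw [Real.rpow_neg (by positivity), ← div_eq_mul_inv, le_div_iff₀ (by positivity)]
    exact h1
  have hm : μ d.succPNat ≤ A * (d : ℝ) ^ (-b) := by
    exact (hμA 0).trans (mul_le_mul_of_nonneg_left
      (Real.rpow_le_rpow_of_nonpos hd' (by simp) (by linarith)) hA0.le)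
  by_cases htop : r = ∞
  · subst htop
    refine (seqNorm_capped_top_le hpos hanti d).trans (ENNReal.ofReal_le_ofReal ?_)
    rw [hγ, hBr, recip_top, Real.rpow_zero, mul_one, sub_zero]
    exact hm
  · have hR := toReal_pos_of_one_le hr1 htop
    rw [hγ, hBr, recip_eq_inv]
    refine seqNorm_capped_le hr1 htop hpos hd0 hA0 (hpos _).le ?_ hm hμA
    rw [hBr, recip_eq_inv, sub_pos, inv_eq_one_div, div_lt_iff₀ hR] at hB
    exact hB

/-- The non-asymptotic upper bound for the entropy, for `q ≤ p`. -/
lemma metricEntropy_le_of_capped_le {p q r : ℝ≥0∞} [Fact (1 ≤ p)] [Fact (1 ≤ q)] (hr1 : 1 ≤ r)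
    (hpqr : p⁻¹ + r⁻¹ = q⁻¹) {μ : ℕ+ → ℝ} (hpos : ∀ n, 0 < μ n) (hanti : Antitone μ) {d : ℕ}
    (hd : 0 < d) {τ : ℝ} (hτ : 0 < τ)
    (hT : seqNorm r (emb (fun _ : Fin d => μ d.succPNat) + tl d μ) ≤ ENNReal.ofReal τ)
    {k : ℕ} (hk : 0 < k) {δ : ℝ} (hδ0 : 0 < δ) (hδ1 : δ < 1) {w : ℝ}
    (hw : w = ∑ i ∈ Finset.range d, Real.log (μ i.succPNat) - d * Real.log (μ d.succPNat)) :
    metricEntropy (τ * (1 + 1 / k)) (ellipsoidIn p q μ) ≤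
      (((Real.log (k + 1) + d * Real.log (2 / (1 - δ)) + w +
        Real.log (d * Real.log ((1 + δ) / δ) + w + 1)) / Real.log 2 : ℝ) : EReal) := by
  have hm := hpos d.succPNat
  -- Monotonicity is what makes the stretched ball contain the unit ball, as the covering lemma
  -- requires.
  have hw1 : ∀ i : Fin d, 1 ≤ μ (i : ℕ).succPNat / μ d.succPNat := fun i => by
    rw [le_div_iff₀ hm, one_mul]
    exact hanti (Nat.succPNat_strictMono.monotone i.2.le)
  have hδ : 0 < 1 - δ := by linarith
  obtain ⟨S, hS, hcard⟩ := exists_finset_cover_scaled_ball (q := q) hd hw1 hδ0 hδ1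
  set W := ∏ i : Fin d, μ (i : ℕ).succPNat / μ d.succPNat with hW
  have hW0 : 0 < W := Finset.prod_pos fun i _ => zero_lt_one.trans_le (hw1 i)
  have hlogW : Real.log W = w := by
    rw [hW, hw, Real.log_prod fun i _ => (zero_lt_one.trans_le (hw1 i)).ne', Finset.sum_range]
    simp only [Real.log_div (hpos _).ne' hm.ne', Finset.sum_sub_distrib, Finset.sum_const,
      Finset.card_univ, Fintype.card_fin, nsmul_eq_mul]
  have hW1 : 1 ≤ W := by
    calc (1 : ℝ) = ∏ _i : Fin d, (1 : ℝ) := by simp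
      _ ≤ W := Finset.prod_le_prod (fun _ _ => zero_le_one) fun i _ => hw1 i
  have hX1 : 1 ≤ (2 / (1 - δ)) ^ d * W := by
    have : 1 ≤ (2 / (1 - δ)) ^ d := one_le_pow₀ (by rw [le_div_iff₀ hδ]; linarith)
    nlinarith
  have hZ : Real.log (((1 + δ) / δ) ^ d * W) = d * Real.log ((1 + δ) / δ) + w := by
    rw [Real.log_mul (by positivity) hW0.ne', Real.log_pow, hlogW]
  have hZ0 : 0 ≤ d * Real.log ((1 + δ) / δ) + w := by
    have h1 : 0 ≤ Real.log ((1 + δ) / δ) := Real.log_nonneg (by rw [le_div_iff₀ hδ0]; linarith)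
    have h2 : 0 ≤ w := by rw [← hlogW]; exact Real.log_nonneg hW1
    positivity
  rw [hZ] at hcard
  set Z := d * Real.log ((1 + δ) / δ) + w with hZdef
  set X := (2 / (1 - δ)) ^ d * W with hX
  have hlogN : Real.log (((k : ℝ) + 1) * (X * (Z + 1))) =
      Real.log (k + 1) + d * Real.log (2 / (1 - δ)) + w + Real.log (Z + 1) := by
    rw [Real.log_mul (by positivity) (by positivity), Real.log_mul (by positivity) (by positivity),
      hX, Real.log_mul (by positivity) hW0.ne', Real.log_pow, hlogW]
    ring
  rw [← hlogN]
  refine metricEntropy_le_of_head_cover hS hτ (fun x hx => ?_) hk ?_ ?_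
  · exact (seqNorm_rescaled_le Fact.out Fact.out hr1 hpqr hpos _ hx).trans hT
  · have h1 : 1 ≤ X * (Z + 1) := by nlinarith
    have h2 : (0 : ℝ) ≤ k := by positivity
    nlinarith
  · gcongr
    nlinarith

/-! ### Asymptotic upper bound for q ≤ p -/

/-- Both the mean of log μ_i and log μ_{d+1} behave like log c - b log d; the extra +b in the mean
comes from Stirling and is the b in the leading constant. -/
lemma tendsto_sum_log_quotient {b c : ℝ} {μ : ℕ+ → ℝ} (hc : 0 < c) (hpos : ∀ n, 0 < μ n)
    (hμ : Tendsto (fun i : ℕ => μ i.succPNat * ((i : ℝ) + 1) ^ b) atTop (𝓝 c)) :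
    Tendsto (fun d : ℕ => (∑ i ∈ Finset.range d, Real.log (μ i.succPNat) -
      d * Real.log (μ d.succPNat)) / d) atTop (𝓝 b) := by
  have h1 := tendsto_sum_log_semiaxis hc hpos hμ
  have h2 := (Real.continuousAt_log hc.ne').tendsto.comp hμ
  have h3 := (Real.tendsto_log_nat_add_one_sub_log).const_mul b
  have h4 := (h1.sub h2).add h3
  rw [show Real.log c + b - Real.log c + b * 0 = b by ring] at h4
  refine h4.congr' ?_
  filter_upwards [eventually_gt_atTop 0] with d hd
  have hd' : (0 : ℝ) < d := by exact_mod_cast hd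
  simp only [Function.comp]
  rw [Real.log_mul (hpos _).ne' (by positivity), Real.log_rpow (by positivity)]
  field_simp
  ring

/-- By log(u + 1) ≤ 2√(u + 1), linear growth of u makes the quotient O(d^(-1/2)). -/
lemma tendsto_log_affine_div {u : ℕ → ℝ} {l : ℝ} (hu : Tendsto (fun d => u d / d) atTop (𝓝 l))
    (hu0 : ∀ᶠ d in atTop, 0 ≤ u d) :
    Tendsto (fun d : ℕ => Real.log (u d + 1) / d) atTop (𝓝 0) := by
  have hsqrt : Tendsto (fun d : ℕ => 2 * Real.sqrt (u d / d + 1 / d) / Real.sqrt d) atTop (𝓝 0) := by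
    have h1 := (hu.add (tendsto_one_div_atTop_nhds_zero_nat (𝕜 := ℝ))).sqrt.const_mul 2
    exact h1.div_atTop (Real.tendsto_sqrt_atTop.comp tendsto_natCast_atTop_atTop)
  refine squeeze_zero' ?_ ?_ hsqrt
  · filter_upwards [hu0] with d hd
    exact div_nonneg (Real.log_nonneg (by linarith)) (by positivity)
  · filter_upwards [hu0, eventually_gt_atTop 0] with d hd hd0
    have hd' : (0 : ℝ) < d := by exact_mod_cast hd0
    have h1 : Real.log (u d + 1) ≤ 2 * Real.sqrt (u d + 1) := by
      have h2 := Real.log_le_sub_one_of_pos (Real.sqrt_pos.2 (show 0 < u d + 1 by linarith))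
      rw [Real.log_sqrt (by linarith)] at h2
      linarith
    have h3 : 2 * Real.sqrt (u d / d + 1 / d) / Real.sqrt d = 2 * Real.sqrt (u d + 1) / d := by
      rw [← add_div, Real.sqrt_div (by linarith), mul_div_assoc, div_div, Real.mul_self_sqrt hd'.le,
        mul_div_assoc]
    rw [h3]
    gcongr

/-- The asymptotic upper bound for the entropy, for `q ≤ p`. -/
lemma eventually_metricEntropy_le {p q : ℝ≥0∞} [Fact (1 ≤ p)] [Fact (1 ≤ q)] (hqp : q ≤ p)
    {b c : ℝ} (hb : 0 < b) (hc : 0 < c) {μ : ℕ+ → ℝ} (hpos : ∀ n, 0 < μ n) (hanti : Antitone μ)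
    (hμ : Tendsto (fun i : ℕ => μ i.succPNat * ((i : ℝ) + 1) ^ b) atTop (𝓝 c))
    (hB : 0 < bStar p q b) {η : ℝ} (hη : 0 < η) :
    ∀ᶠ ε : ℝ in 𝓝[>] 0, metricEntropy ε (ellipsoidIn p q μ) ≤
      (((b / Real.log 2 + 1) * (gammaConst p q b * c / ε) ^ (1 / bStar p q b) +
        η * ε ^ (-(1 / bStar p q b)) : ℝ) : EReal) := by
  obtain ⟨r, hr1, hpqr, hr⟩ := exists_holder_exponent (p := p) (q := q) Fact.out hqp
  have hγ := gammaConst_pos hb hB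
  set B := bStar p q b with hBdef
  set γ := gammaConst p q b with hγdef
  set K := γ * c with hK
  have hK0 : 0 < K := by positivity
  have hlog2 := Real.log_pos one_lt_two
  set η' := η * Real.log 2 / K ^ (1 / B) with hη'
  have hη'0 : 0 < η' := by positivity
  -- The last estimate expands (log 2 + b + 2θ)(1 + 2θ), whose excess is θ(2(log 2 + b) + 2 + 4θ); θ
  -- ≤ 1 turns 2 + 4θ into the 6.
  set θ := min 1 (η' / (2 * (Real.log 2 + b) + 6)) with hθ
  have hθ0 : 0 < θ := by positivity
  have hθ1 : θ ≤ 1 := min_le_left _ _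
  have hθη : θ * (2 * (Real.log 2 + b) + 6) ≤ η' := by
    rw [← le_div_iff₀ (by positivity)]
    exact min_le_right _ _
  -- Two losses of a factor σ in the radius, from A = cσ and from 1 + 1/(k + 1) ≤ σ, are paid for by
  -- enlarging d by 1 + θ, as σ² = (1 + θ)^B.
  set σ := (1 + θ) ^ (B / 2) with hσ
  have hσ1 : 1 < σ := Real.one_lt_rpow (by linarith) (by positivity)
  obtain ⟨k, hk⟩ := exists_nat_one_div_lt (sub_pos.2 hσ1)
  -- Chosen so that log(2/(1 - δ)) = log 2 + θ exactly.
  set δ := 1 - Real.exp (-θ) with hδ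
  have hδ0 : 0 < δ := by rw [hδ, sub_pos, Real.exp_lt_one_iff]; linarith
  have hδ1 : δ < 1 := by rw [hδ]; have := Real.exp_pos (-θ); linarith
  have hlogδ : Real.log (2 / (1 - δ)) = Real.log 2 + θ := by
    rw [hδ, sub_sub_cancel, Real.log_div two_ne_zero (Real.exp_pos _).ne', Real.log_exp]
    ring
  let w : ℕ → ℝ := fun d =>
    ∑ i ∈ Finset.range d, Real.log (μ i.succPNat) - d * Real.log (μ d.succPNat)
  have hw : Tendsto (fun d : ℕ => w d / d) atTop (𝓝 b) := tendsto_sum_log_quotient hc hpos hμ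
  have hw0 : ∀ d, 0 ≤ w d := fun d => by
    have : ∑ i ∈ Finset.range d, Real.log (μ d.succPNat) ≤
        ∑ i ∈ Finset.range d, Real.log (μ i.succPNat) := Finset.sum_le_sum fun i hi =>
      Real.log_le_log (hpos _) (hanti (Nat.succPNat_strictMono.monotone
        (Finset.mem_range.1 hi).le))
    rw [Finset.sum_const, Finset.card_range, nsmul_eq_mul] at this
    exact sub_nonneg.2 this
  have hlδ : 0 ≤ Real.log ((1 + δ) / δ) := Real.log_nonneg (by rw [le_div_iff₀ hδ0]; linarith)
  have hu : Tendsto (fun d : ℕ => (d * Real.log ((1 + δ) / δ) + w d) / d) atTop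
      (𝓝 (Real.log ((1 + δ) / δ) + b)) := by
    refine (hw.const_add (Real.log ((1 + δ) / δ))).congr' ?_
    filter_upwards [eventually_gt_atTop 0] with d hd
    have hd' : (0 : ℝ) < d := by exact_mod_cast hd
    field_simp
  have hΦ : Tendsto (fun d : ℕ => (Real.log ((k + 1 : ℕ) + 1) + d * Real.log (2 / (1 - δ)) + w d +
      Real.log (d * Real.log ((1 + δ) / δ) + w d + 1)) / d) atTop
      (𝓝 (Real.log 2 + θ + b)) := by
    have h1 := ((tendsto_const_div_atTop_nhds_zero_nat (Real.log ((k + 1 : ℕ) + 1))).add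
      (hw.const_add (Real.log 2 + θ))).add (tendsto_log_affine_div hu
        (Eventually.of_forall fun d => add_nonneg (mul_nonneg (by positivity) hlδ) (hw0 d)))
    rw [zero_add, add_zero] at h1
    refine h1.congr' ?_
    filter_upwards [eventually_gt_atTop 0] with d hd
    have hd' : (0 : ℝ) < d := by exact_mod_cast hd
    rw [hlogδ]
    field_simp
    ring
  have hcap := eventually_capped_le hr1 hr hc hpos hanti hμ hb hB
    (show c < c * σ by nlinarith)
  have hL := tendsto_div_rpow_atTop hK0 hB
  have hd := (tendsto_nat_ceil_atTop (α := ℝ)).comp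
    (hL.const_mul_atTop (show 0 < 1 + θ by linarith))
  filter_upwards [hd.eventually hcap, hd.eventually (hΦ.eventually (gt_mem_nhds
    (show Real.log 2 + θ + b < Real.log 2 + θ + b + θ by linarith))),
    hL.eventually_ge_atTop (1 / θ), self_mem_nhdsWithin] with ε h1 h2 h3 h4
  have hε : 0 < ε := h4
  simp only [Function.comp] at h1 h2
  have hLε := div_rpow_eq (B := B) hK0 hε
  have hLB : ((K / ε) ^ (1 / B)) ^ (-B) = ε / K := by
    rw [← Real.rpow_mul (by positivity), mul_neg, one_div_mul_cancel hB.ne', Real.rpow_neg_one,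
      inv_div]
  set L := (K / ε) ^ (1 / B) with hLdef
  have hL0 : 0 < L := by positivity
  set d := ⌈(1 + θ) * L⌉₊ with hddef
  have hd0 : 0 < d := Nat.ceil_pos.2 (by positivity)
  have hd0' : (0 : ℝ) < d := by exact_mod_cast hd0
  have hdL : (1 + θ) * L ≤ d := Nat.le_ceil _
  have hLd : (d : ℝ) < (1 + θ) * L + 1 := Nat.ceil_lt_add_one (by positivity)
  set τ := c * σ * γ * (d : ℝ) ^ (-B) with hτ
  have hτ0 : 0 < τ := by positivity
  have hmain := metricEntropy_le_of_capped_le hr1 hpqr hpos hanti hd0 hτ0 h1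
    (k := k + 1) k.succ_pos
    hδ0 hδ1 (w := w d) rfl
  have hrad : τ * (1 + 1 / ((k + 1 : ℕ) : ℝ)) ≤ ε := by
    have e1 : 1 + 1 / ((k + 1 : ℕ) : ℝ) ≤ σ := by push_cast; linarith
    have e2 : (d : ℝ) ^ (-B) ≤ (1 + θ) ^ (-B) * (ε / K) := by
      rw [← hLB, ← Real.mul_rpow (by positivity) hL0.le]
      exact Real.rpow_le_rpow_of_nonpos (by positivity) hdL (by linarith)
    have e3 : σ * σ = (1 + θ) ^ B := by
      rw [hσ, ← Real.rpow_add (by positivity)]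
      congr 1
      ring
    calc τ * (1 + 1 / ((k + 1 : ℕ) : ℝ)) ≤ (c * σ * γ * ((1 + θ) ^ (-B) * (ε / K))) * σ := by
          rw [hτ]; gcongr
      _ = (σ * σ) * (1 + θ) ^ (-B) * (γ * c / K) * ε := by ring
      _ = ε := by
          rw [e3, ← Real.rpow_add (by positivity), add_neg_cancel, Real.rpow_zero, ← hK,
            div_self hK0.ne', one_mul, one_mul]
  refine (metricEntropy_anti hrad _).trans (hmain.trans (EReal.coe_le_coe_iff.2 ?_))
  have hrew : (b / Real.log 2 + 1) * L + η * ε ^ (-(1 / B)) =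
      ((Real.log 2 + b) * L + η' * L) / Real.log 2 := by
    have : K ^ (1 / B) ≠ 0 := by positivity
    rw [hLε, hη']
    field_simp
    ring
  rw [hrew]
  refine div_le_div_of_nonneg_right ?_ hlog2.le
  rw [div_lt_iff₀ hd0'] at h2
  refine h2.le.trans ?_
  have h5 : 1 ≤ θ * L := by rw [div_le_iff₀ hθ0] at h3; linarith
  have h6 : (d : ℝ) ≤ (1 + 2 * θ) * L := by linarith
  calc (Real.log 2 + θ + b + θ) * d ≤ (Real.log 2 + θ + b + θ) * ((1 + 2 * θ) * L) := by gcongr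
    _ = ((Real.log 2 + b) + (θ * (2 * (Real.log 2 + b) + 2 + 4 * θ))) * L := by ring
    _ ≤ ((Real.log 2 + b) + η') * L := by
        gcongr
        exact le_trans (mul_le_mul_of_nonneg_left (by linarith) hθ0.le) hθη
    _ = _ := by ring

/-- For `q ≤ p` above the threshold, the entropy is finite at every scale. -/
lemma metricEntropy_ne_top {p q : ℝ≥0∞} [Fact (1 ≤ p)] [Fact (1 ≤ q)] (hqp : q ≤ p)
    {b c : ℝ} (hb : 0 < b) (hc : 0 < c) {μ : ℕ+ → ℝ} (hpos : ∀ n, 0 < μ n) (hanti : Antitone μ)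
    (hμ : Tendsto (fun i : ℕ => μ i.succPNat * ((i : ℝ) + 1) ^ b) atTop (𝓝 c))
    (hB : 0 < bStar p q b) {ε : ℝ} (hε : 0 < ε) :
    metricEntropy ε (ellipsoidIn p q μ) ≠ ⊤ := by
  obtain ⟨ε', h, hε'⟩ := ((eventually_metricEntropy_le hqp hb hc hpos hanti hμ hB one_pos).and
    (Ioo_mem_nhdsGT hε)).exists
  exact ne_top_of_le_ne_top (EReal.coe_ne_top _) ((metricEntropy_anti hε'.2.le _).trans h)

/-- Hölder bounds the tail in ℓ^q, and the head is finite-dimensional. -/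
lemma memℓp_of_mem_ellipsoid {p q : ℝ≥0∞} [Fact (1 ≤ p)] [Fact (1 ≤ q)] (hqp : q ≤ p)
    {b c : ℝ} (hb : 0 < b) (hc : 0 < c) {μ : ℕ+ → ℝ} (hpos : ∀ n, 0 < μ n) (hanti : Antitone μ)
    (hμ : Tendsto (fun i : ℕ => μ i.succPNat * ((i : ℝ) + 1) ^ b) atTop (𝓝 c))
    (hB : 0 < bStar p q b) {x : ℕ+ → ℝ} (hx : x ∈ ellipsoid p μ) : Memℓp x q := by
  have hq1 : 1 ≤ q := Fact.out
  obtain ⟨r, hr1, hpqr, hr⟩ := exists_holder_exponent (p := p) (q := q) hq1 hqp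
  obtain ⟨d, hd⟩ := (eventually_capped_le hr1 hr hc hpos hanti hμ hb hB
    (show c < 2 * c by linarith)).exists
  have h1 := (seqNorm_rescaled_le Fact.out hq1 hr1 hpqr hpos _ hx).trans hd
  rw [memℓp_iff_seqNorm_lt_top hq1, ← emb_hd_add_tl d x]
  refine (seqNorm_add_le hq1 _ _).trans_lt (ENNReal.add_lt_top.2 ⟨?_, ?_⟩)
  · rw [seqNorm_emb]
    exact ENNReal.ofReal_lt_top
  · refine lt_of_le_of_lt (seqNorm_mono fun n => ?_) (h1.trans_lt ENNReal.ofReal_lt_top)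
    by_cases hn : n.natPred < d <;> simp [emb, tl, hn]

/-! ### Remainder terms and conclusion -/

lemma metricEntropy_nonneg {X : Type*} [PseudoEMetricSpace X] {A : Set X} (hA : A.Nonempty)
    (ε : ℝ) : 0 ≤ metricEntropy ε A := by
  have := le_metricEntropy (ε := ε) (K := 0) hA fun C _ _ => Real.log_natCast_nonneg _
  simpa using this

/-- Asymptotic lower bounds with arbitrarily small relative error give a bound with an `o`-term. -/
lemma exists_isLittleO_le {H : ℝ → EReal} (hH0 : ∀ ε, 0 ≤ H ε) {m g : ℝ → ℝ}
    (hg : ∀ ε, 0 < ε → 0 ≤ g ε)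
    (h : ∀ η : ℝ, 0 < η → ∀ᶠ ε in 𝓝[>] 0, ((m ε - η * g ε : ℝ) : EReal) ≤ H ε) :
    ∃ r : ℝ → ℝ, r =o[𝓝[>] 0] g ∧ ∀ ε : ℝ, 0 < ε → ((m ε + r ε : ℝ) : EReal) ≤ H ε := by
  classical
  -- The remainder is the exact deficit of H below m, if any; where H is infinite nothing is needed.
  refine ⟨fun ε => if H ε = ⊤ then 0 else min 0 ((H ε).toReal - m ε), ?_, fun ε _ => ?_⟩
  · refine isLittleO_iff.2 fun η hη => ?_
    filter_upwards [h η hη, self_mem_nhdsWithin] with ε h1 h2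
    have hg0 := hg ε h2
    split_ifs with ht
    · rw [norm_zero]; positivity
    · have hbot : H ε ≠ ⊥ := ne_of_gt (lt_of_lt_of_le EReal.bot_lt_zero (hH0 ε))
      rw [← EReal.coe_toReal ht hbot, EReal.coe_le_coe_iff] at h1
      rw [Real.norm_of_nonpos (min_le_left _ _), Real.norm_of_nonneg hg0, neg_le]
      exact le_min (by nlinarith) (by linarith)
  · beta_reduce
    split_ifs with ht
    · rw [ht]; exact le_top
    · have hbot : H ε ≠ ⊥ := ne_of_gt (lt_of_lt_of_le EReal.bot_lt_zero (hH0 ε))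
      refine le_trans (EReal.coe_le_coe_iff.2 ?_) (EReal.coe_toReal ht hbot).le
      linarith [min_le_right 0 ((H ε).toReal - m ε)]

/-- Asymptotic upper bounds with arbitrarily small relative error give a bound with an `o`-term. -/
lemma exists_le_isLittleO {H : ℝ → EReal} (hH0 : ∀ ε, 0 ≤ H ε) (hHt : ∀ ε, 0 < ε → H ε ≠ ⊤)
    {m g : ℝ → ℝ} (hg : ∀ ε, 0 < ε → 0 ≤ g ε)
    (h : ∀ η : ℝ, 0 < η → ∀ᶠ ε in 𝓝[>] 0, H ε ≤ ((m ε + η * g ε : ℝ) : EReal)) :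
    ∃ r : ℝ → ℝ, r =o[𝓝[>] 0] g ∧ ∀ ε : ℝ, 0 < ε → H ε ≤ ((m ε + r ε : ℝ) : EReal) := by
  have hbot : ∀ ε, H ε ≠ ⊥ := fun ε => ne_of_gt (lt_of_lt_of_le EReal.bot_lt_zero (hH0 ε))
  -- The bound is claimed at every ε > 0, not only for small ones, hence the need for H to be finite
  -- at every scale.
  refine ⟨fun ε => max 0 ((H ε).toReal - m ε), ?_, fun ε hε => ?_⟩
  · refine isLittleO_iff.2 fun η hη => ?_
    filter_upwards [h η hη, self_mem_nhdsWithin] with ε h1 h2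
    have hg0 := hg ε h2
    rw [← EReal.coe_toReal (hHt ε h2) (hbot ε), EReal.coe_le_coe_iff] at h1
    rw [Real.norm_of_nonneg (le_max_left _ _), Real.norm_of_nonneg hg0]
    exact max_le (by positivity) (by linarith)
  · refine (EReal.coe_toReal (hHt ε hε) (hbot ε)).ge.trans (EReal.coe_le_coe_iff.2 ?_)
    linarith [le_max_right 0 ((H ε).toReal - m ε)]

/-- A bound by `C g` gives a bound by `C g u` for every `u` that tends to infinity. -/
lemma eventually_le_mul_of_le {H : ℝ → EReal} {g u : ℝ → ℝ} (hg : ∀ ε, 0 < ε → 0 ≤ g ε)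
    (hu : ∀ᶠ ε in 𝓝[>] 0, 1 ≤ u ε)
    (h : ∃ C : ℝ, 0 < C ∧ ∀ ε : ℝ, 0 < ε → ε ≤ 1 → H ε ≤ ((C * g ε : ℝ) : EReal)) :
    ∃ C : ℝ, 0 < C ∧ ∀ᶠ ε in 𝓝[>] 0, H ε ≤ ((C * (g ε * u ε) : ℝ) : EReal) := by
  obtain ⟨C, hC, h⟩ := h
  refine ⟨C, hC, ?_⟩
  filter_upwards [hu, Ioo_mem_nhdsGT (zero_lt_one (α := ℝ))] with ε h1 h2
  refine (h ε h2.1 h2.2.le).trans (EReal.coe_le_coe_iff.2 ?_)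
  gcongr
  exact le_mul_of_one_le_right (hg ε h2.1) h1

lemma tendsto_logb_inv : Tendsto (fun ε : ℝ => Real.logb 2 ε⁻¹) (𝓝[>] 0) atTop :=
  (Real.tendsto_logb_atTop one_lt_two).comp tendsto_inv_nhdsGT_zero

end EllipsoidEntropy

open EllipsoidEntropy in
theorem mainTheorem6 (p q : ℝ≥0∞) [Fact (1 ≤ p)] [Fact (1 ≤ q)] (b c : ℝ) (hb : 0 < b) (hc : 0 < c)
    (μ : ℕ+ → ℝ) (hpos : ∀ n, 0 < μ n) (hanti : Antitone μ)
    (hμ : (fun n : ℕ+ => μ n - c / (n : ℝ) ^ b) =o[atTop] fun n : ℕ+ => 1 / (n : ℝ) ^ b) :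
    -- (i)
    (q ≤ EllipsoidEntropy.threshold p b →
      ¬ IsCompact (EllipsoidEntropy.ellipsoidIn p q μ) ∧
      ∃ εstar : ℝ, 0 < εstar ∧ ∀ ε : ℝ, 0 < ε → ε < εstar →
        EllipsoidEntropy.metricEntropy ε (EllipsoidEntropy.ellipsoidIn p q μ) = ⊤) ∧
    -- (ii)
    (EllipsoidEntropy.threshold p b < q → q ≤ p →
      (∀ x ∈ EllipsoidEntropy.ellipsoid p μ, Memℓp x q) ∧
      ∃ r₁ r₂ : ℝ → ℝ,
        (r₁ =o[𝓝[>] 0] fun ε => ε ^ (-(1 / EllipsoidEntropy.bStar p q b))) ∧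
        (r₂ =o[𝓝[>] 0] fun ε => ε ^ (-(1 / EllipsoidEntropy.bStar p q b))) ∧
        ∀ ε : ℝ, 0 < ε →
          ((b / Real.log 2 * (EllipsoidEntropy.GammaConst p q * c / ε) ^
              (1 / EllipsoidEntropy.bStar p q b) + r₁ ε : ℝ) : EReal) ≤
            EllipsoidEntropy.metricEntropy ε (EllipsoidEntropy.ellipsoidIn p q μ) ∧
          EllipsoidEntropy.metricEntropy ε (EllipsoidEntropy.ellipsoidIn p q μ) ≤
            (((b / Real.log 2 + 1) * (EllipsoidEntropy.gammaConst p q b * c / ε) ^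
              (1 / EllipsoidEntropy.bStar p q b) + r₂ ε : ℝ) : EReal)) ∧
    -- (iii)
    (p < q →
      (∀ x ∈ EllipsoidEntropy.ellipsoid p μ, Memℓp x q) ∧
      (∃ r : ℝ → ℝ,
        (r =o[𝓝[>] 0] fun ε => ε ^ (-(1 / EllipsoidEntropy.bStar p q b))) ∧
        ∀ ε : ℝ, 0 < ε →
          ((b / Real.log 2 * (EllipsoidEntropy.GammaConst p q * c / ε) ^
              (1 / EllipsoidEntropy.bStar p q b) + r ε : ℝ) : EReal) ≤
            EllipsoidEntropy.metricEntropy ε (EllipsoidEntropy.ellipsoidIn p q μ)) ∧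
      (1 ≤ b → ∃ C : ℝ, 0 < C ∧ ∀ᶠ ε : ℝ in 𝓝[>] 0,
        EllipsoidEntropy.metricEntropy ε (EllipsoidEntropy.ellipsoidIn p q μ) ≤
          ((C * (ε ^ (-(1 / EllipsoidEntropy.bStar p q b)) *
            Real.logb 2 (Real.logb 2 ε⁻¹)) : ℝ) : EReal)) ∧
      (b < 1 → ∃ C : ℝ, 0 < C ∧ ∀ᶠ ε : ℝ in 𝓝[>] 0,
        EllipsoidEntropy.metricEntropy ε (EllipsoidEntropy.ellipsoidIn p q μ) ≤
          ((C * (ε ^ (-(1 / EllipsoidEntropy.bStar p q b)) *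
            (Real.logb 2 ε⁻¹) ^ (1 - b)) : ℝ) : EReal))) := by
  have hp1 : 1 ≤ p := Fact.out
  have hq1 : 1 ≤ q := Fact.out
  have hμ' := tendsto_semiaxis hμ
  have hH0 : ∀ ε, 0 ≤ metricEntropy ε (ellipsoidIn p q μ) :=
    metricEntropy_nonneg (ellipsoidIn_nonempty p q μ)
  have hg : ∀ ε : ℝ, 0 < ε → 0 ≤ ε ^ (-(1 / bStar p q b)) := fun ε hε => by positivity
  refine ⟨fun h => ?_, fun hthr hqp => ?_, fun hpq => ?_⟩
  · have hbd := not_isBounded_of_le_threshold (p := p) (q := q) hb hc hpos hμ' h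
    -- The value 1 is arbitrary: the entropy is infinite at every radius.
    exact ⟨fun hcomp => hbd hcomp.isBounded, 1, one_pos,
      fun ε _ _ => metricEntropy_eq_top_of_not_isBounded hbd ε⟩
  · have hB := bStar_pos_of_threshold_lt hp1 hq1 hb hthr
    obtain ⟨r₁, hr₁, h₁⟩ := exists_isLittleO_le hH0 hg
      fun η hη => eventually_le_metricEntropy hb hc hpos hμ' hB hη
    obtain ⟨r₂, hr₂, h₂⟩ := exists_le_isLittleO hH0
      (fun ε hε => metricEntropy_ne_top hqp hb hc hpos hanti hμ' hB hε) hg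
      fun η hη => eventually_metricEntropy_le hqp hb hc hpos hanti hμ' hB hη
    exact ⟨fun x hx => memℓp_of_mem_ellipsoid hqp hb hc hpos hanti hμ' hB hx,
      r₁, r₂, hr₁, hr₂, fun ε hε => ⟨h₁ ε hε, h₂ ε hε⟩⟩
  · have hB : 0 < bStar p q b := by
      have := recip_lt_recip hp1 hpq
      unfold bStar
      linarith
    have hupper := exists_metricEntropy_le (q := q) hpq hb hpos hμ'
    refine ⟨fun x hx => hx.1.of_exponent_ge hpq.le, exists_isLittleO_le hH0 hg
      fun η hη => eventually_le_metricEntropy hb hc hpos hμ' hB hη, fun _ => ?_, fun hb1 => ?_⟩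
    -- `hupper` has no logarithm; here and in the case b < 1 the logarithmic factor tends to
    -- infinity, hence is eventually at least 1.
    · exact eventually_le_mul_of_le hg (((Real.tendsto_logb_atTop one_lt_two).comp
        tendsto_logb_inv).eventually_ge_atTop 1) hupper
    · exact eventually_le_mul_of_le hg (((tendsto_rpow_atTop (by linarith)).comp
        tendsto_logb_inv).eventually_ge_atTop 1) hupper
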